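/- Let $1<p,q,r<\infty$ with $q>r$ and $\frac1p+\frac1q+\frac1r=1$. For coefficients $A,B,C>0$ define $\mathcal A\colon[0,\infty)^3\to\mathbb R$ by \[ \mathcal A(u,v,w)=\begin{cases} Au^p+Bv^q+Cw^r, & u^p\le w^r\le v^q,\\[2pt] \frac{A(p-1)-C}{p-1}u^p+Bv^q+\frac{Cp}{p-1}uw^{r-\frac rp}, & w^r\le u^p\le v^q,\\[2pt] \frac{A(p-1)-(B+C)}{p-1}u^p+\frac{Bp}{p-1}uv^{q-\frac qp}+\frac{Cp}{p-1}uw^{r-\frac rp}, & w^r\le v^q\le u^p,\\[2pt] \frac{A(p-1)-(B+C)}{p-1}u^p+\frac{Bq}{2}uv^2w^{1-\frac rq}+\frac{2Cpr-Bp(q-r)}{2r(p-1)}uw^{r-\frac rp}, & v^q\le w^r\le u^p,\\[2pt] \frac{2Ar(p-1)-B(q+r)}{2r(p-1)}u^p+\frac{Bq^2}{2p(q-2)}u^{p-\frac{2p}{q}}v^2+\frac{Bq(q-r)}{2r(q-2)}v^2w^{r-\frac{2r}{q}}+\frac{2Cr-B(q-r)}{2r}w^r, & v^q\le u^p\le w^r,\\[2pt]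 Au^p+\frac{Bq}{p(q-2)}v^q+\frac{Bq(q-r)}{2r(q-2)}v^2w^{r-\frac{2r}{q}}+\frac{2Cr-B(q-r)}{2r}w^r, & u^p\le v^q\le w^r, \end{cases} \] put $\mathcal C_{p,q,r}=\max\{Ap,Bq,Cr\}$, and on $\mathbb D=\{(u,v,w,U,V,W)\in[0,\infty)^6: u^p\le U,\ v^q\le V,\ w^r\le W\}$ define \[\mathcal B(u,v,w,U,V,W)=\mathcal C_{p,q,r}\Big(\frac1pU+\frac1qV+\frac1rW\Big)-\mathcal A(u,v,w).\] Then one can choose $A,B,C>0$, depending only on $p,q,r$, such that the six formulas agree wherever the regions overlap and the following hold. (C1) $\mathcal B$ is of class $C^1$ on $\mathbb D$, in the sense that $\mathcal A$ is continuous on $[0,\infty)^3$ and continuously differentiable on $(0,\infty)^3$, and its partial derivatives extend continuously to $[0,\infty)^3$. (At boundary points the differentials $d\mathcal A$ and $d\mathcal B$ are defined by these extensions.) (B2) For all $(u,v,w,U,V,W)\in\mathbb D$, \[0\le\mathcal B(u,v,w,U,V,W)\le\mathcal C_{p,q,r}\Big(\frac1pU+\frac1qV+\frac1rW\Big).\]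 (B3) If $\mathbf x=(u,v,w,U,V,W)$ and $\mathbf x_i=(u_i,v_i,w_i,U_i,V_i,W_i)$, $i=1,2$, belong to $\mathbb D$ and $\mathbf x=\frac12\mathbf x_1+\frac12\mathbf x_2$, then \[\mathcal B(\mathbf x)\ge\frac12\mathcal B(\mathbf x_1)+\frac12\mathcal B(\mathbf x_2)+u\,\frac{|v_1-v_2|}2\,\frac{|w_1-w_2|}2.\] (B4) For all $\mathbf x=(u,v,w,U,V,W)$ and $\mathbf x_1=(u_1,v_1,w_1,U_1,V_1,W_1)$ in $\mathbb D$, \[\mathcal B(\mathbf x)+(d\mathcal B)(\mathbf x)(\mathbf x_1-\mathbf x)\ge\mathcal B(\mathbf x_1)+\frac23\,u\,|v_1-v|\,|w_1-w|.\] One possible choice is \[A=\frac{88q^4r}{(p-1)(r-1)(q-r)},\qquad B=1,\qquad C=\frac{11q^3r}{(r-1)(q-r)},\] and for this choice \[\mathcal C_{p,q,r}=\frac{88pq^4r}{(p-1)(r-1)(q-r)}.\] -/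

import Mathlib

noncomputable section

namespace Bellman

/-- The closed octant `[0, ∞)³`, with points written `(u, v, w)`. -/
def closedOctant : Set (ℝ × ℝ × ℝ) := {z | 0 ≤ z.1 ∧ 0 ≤ z.2.1 ∧ 0 ≤ z.2.2}

/-- The open octant `(0, ∞)³`. -/
def openOctant : Set (ℝ × ℝ × ℝ) := {z | 0 < z.1 ∧ 0 < z.2.1 ∧ 0 < z.2.2}

/-- The domain `𝔻`. A six-tuple `(u, v, w, U, V, W)` is stored as the pair of triples
`x.1 = (u, v, w)` and `x.2 = (U, V, W)`. -/
def domain (p q r : ℝ) : Set ((ℝ × ℝ × ℝ) × (ℝ × ℝ × ℝ)) :=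
  {x | x.1 ∈ closedOctant ∧ x.2 ∈ closedOctant ∧
    x.1.1 ^ p ≤ x.2.1 ∧ x.1.2.1 ^ q ≤ x.2.2.1 ∧ x.1.2.2 ^ r ≤ x.2.2.2}

/-- Formula for the region `u^p ≤ w^r ≤ v^q`. -/
def formula1 (p q r A B C u v w : ℝ) : ℝ :=
  A * u ^ p + B * v ^ q + C * w ^ r

/-- Formula for the region `w^r ≤ u^p ≤ v^q`. -/
def formula2 (p q r A B C u v w : ℝ) : ℝ :=
  (A * (p - 1) - C) / (p - 1) * u ^ p + B * v ^ q
    + C * p / (p - 1) * u * w ^ (r - r / p)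

/-- Formula for the region `w^r ≤ v^q ≤ u^p`. -/
def formula3 (p q r A B C u v w : ℝ) : ℝ :=
  (A * (p - 1) - (B + C)) / (p - 1) * u ^ p
    + B * p / (p - 1) * u * v ^ (q - q / p)
    + C * p / (p - 1) * u * w ^ (r - r / p)

/-- Formula for the region `v^q ≤ w^r ≤ u^p`. -/
def formula4 (p q r A B C u v w : ℝ) : ℝ :=
  (A * (p - 1) - (B + C)) / (p - 1) * u ^ p
    + B * q / 2 * u * v ^ 2 * w ^ (1 - r / q)
    + (2 * C * p * r - B * p * (q - r)) / (2 * r * (p - 1)) * u * w ^ (r - r / p)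

/-- Formula for the region `v^q ≤ u^p ≤ w^r`. -/
def formula5 (p q r A B C u v w : ℝ) : ℝ :=
  (2 * A * r * (p - 1) - B * (q + r)) / (2 * r * (p - 1)) * u ^ p
    + B * q ^ 2 / (2 * p * (q - 2)) * u ^ (p - 2 * p / q) * v ^ 2
    + B * q * (q - r) / (2 * r * (q - 2)) * v ^ 2 * w ^ (r - 2 * r / q)
    + (2 * C * r - B * (q - r)) / (2 * r) * w ^ r

/-- Formula for the region `u^p ≤ v^q ≤ w^r`. -/
def formula6 (p q r A B C u v w : ℝ) : ℝ :=
  A * u ^ p + B * q / (p * (q - 2)) * v ^ q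
    + B * q * (q - r) / (2 * r * (q - 2)) * v ^ 2 * w ^ (r - 2 * r / q)
    + (2 * C * r - B * (q - r)) / (2 * r) * w ^ r

open scoped Classical in
/-- The piecewise function `𝒜`. The six closed regions cover the octant; on their overlaps the
first applicable formula is used (see `AgreesWithFormulas` for the consistency). -/
def funA (p q r A B C : ℝ) (z : ℝ × ℝ × ℝ) : ℝ :=
  let u := z.1
  let v := z.2.1
  let w := z.2.2
  if u ^ p ≤ w ^ r ∧ w ^ r ≤ v ^ q then formula1 p q r A B C u v w
  else if w ^ r ≤ u ^ p ∧ u ^ p ≤ v ^ q then formula2 p q r A B C u v w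
  else if w ^ r ≤ v ^ q ∧ v ^ q ≤ u ^ p then formula3 p q r A B C u v w
  else if v ^ q ≤ w ^ r ∧ w ^ r ≤ u ^ p then formula4 p q r A B C u v w
  else if v ^ q ≤ u ^ p ∧ u ^ p ≤ w ^ r then formula5 p q r A B C u v w
  else formula6 p q r A B C u v w

/-- The six-case definition of `𝒜` is consistent: `𝒜` is given by each of the six formulas
on the whole of the corresponding closed region of the closed octant. -/
def AgreesWithFormulas (p q r A B C : ℝ) : Prop :=
  ∀ u v w : ℝ, 0 ≤ u → 0 ≤ v → 0 ≤ w →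
    (u ^ p ≤ w ^ r → w ^ r ≤ v ^ q → funA p q r A B C (u, v, w) = formula1 p q r A B C u v w) ∧
    (w ^ r ≤ u ^ p → u ^ p ≤ v ^ q → funA p q r A B C (u, v, w) = formula2 p q r A B C u v w) ∧
    (w ^ r ≤ v ^ q → v ^ q ≤ u ^ p → funA p q r A B C (u, v, w) = formula3 p q r A B C u v w) ∧
    (v ^ q ≤ w ^ r → w ^ r ≤ u ^ p → funA p q r A B C (u, v, w) = formula4 p q r A B C u v w) ∧
    (v ^ q ≤ u ^ p → u ^ p ≤ w ^ r → funA p q r A B C (u, v, w) = formula5 p q r A B C u v w) ∧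
    (u ^ p ≤ v ^ q → v ^ q ≤ w ^ r → funA p q r A B C (u, v, w) = formula6 p q r A B C u v w)

/-- The constant `𝒞_{p,q,r} = max {A p, B q, C r}`. -/
def bellmanConst (p q r A B C : ℝ) : ℝ := max (A * p) (max (B * q) (C * r))

/-- The Bellman function `ℬ(u,v,w,U,V,W) = 𝒞 (U/p + V/q + W/r) - 𝒜(u,v,w)`. -/
def funB (p q r A B C : ℝ) (x : (ℝ × ℝ × ℝ) × (ℝ × ℝ × ℝ)) : ℝ :=
  bellmanConst p q r A B C * (1 / p * x.2.1 + 1 / q * x.2.2.1 + 1 / r * x.2.2.2)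
    - funA p q r A B C x.1

/-- The differential of `𝒜` on the closed octant: the limit of the Fréchet derivatives of `𝒜`
at points of the open octant. (That it is the continuous extension of the derivative is part of
`IsC1`.) -/
def diffA (p q r A B C : ℝ) : ℝ × ℝ × ℝ → (ℝ × ℝ × ℝ →L[ℝ] ℝ) :=
  extendFrom openOctant (fderiv ℝ (funA p q r A B C))

/-- The differential of `ℬ` at `x`, applied to the vector `h`. -/
def diffB (p q r A B C : ℝ) (x h : (ℝ × ℝ × ℝ) × (ℝ × ℝ × ℝ)) : ℝ :=
  bellmanConst p q r A B C * (1 / p * h.2.1 + 1 / q * h.2.2.1 + 1 / r * h.2.2.2)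
    - diffA p q r A B C x.1 h.1

/-- `ℬ` is of class `C¹` on `𝔻`: `𝒜` is continuous on the closed octant, continuously
differentiable on the open octant, and its derivative extends continuously to the closed octant
(the extension being `diffA`). -/
def IsC1 (p q r A B C : ℝ) : Prop :=
  ContinuousOn (funA p q r A B C) closedOctant ∧
  ContDiffOn ℝ 1 (funA p q r A B C) openOctant ∧
  (∀ z ∈ openOctant, diffA p q r A B C z = fderiv ℝ (funA p q r A B C) z) ∧
  ContinuousOn (diffA p q r A B C) closedOctant

/-- The range condition. -/
def RangeBound (p q r A B C : ℝ) : Prop :=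
  ∀ x ∈ domain p q r,
    0 ≤ funB p q r A B C x ∧
    funB p q r A B C x ≤
      bellmanConst p q r A B C * (1 / p * x.2.1 + 1 / q * x.2.2.1 + 1 / r * x.2.2.2)

/-- The main inequality. -/
def MainInequality (p q r A B C : ℝ) : Prop :=
  ∀ x ∈ domain p q r, ∀ x₁ ∈ domain p q r, ∀ x₂ ∈ domain p q r,
    x = (1 / 2 : ℝ) • x₁ + (1 / 2 : ℝ) • x₂ →
    1 / 2 * funB p q r A B C x₁ + 1 / 2 * funB p q r A B C x₂
        + x.1.1 * (|x₁.1.2.1 - x₂.1.2.1| / 2) * (|x₁.1.2.2 - x₂.1.2.2| / 2)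
      ≤ funB p q r A B C x

/-- The tangent plane inequality. -/
def TangentInequality (p q r A B C : ℝ) : Prop :=
  ∀ x ∈ domain p q r, ∀ x₁ ∈ domain p q r,
    funB p q r A B C x₁
        + 2 / 3 * x.1.1 * |x₁.1.2.1 - x.1.2.1| * |x₁.1.2.2 - x.1.2.2|
      ≤ funB p q r A B C x + diffB p q r A B C x (x₁ - x)

/-- All the required properties of the coefficients `A, B, C`. -/
def Admissible (p q r A B C : ℝ) : Prop :=
  (0 < A ∧ 0 < B ∧ 0 < C) ∧
  AgreesWithFormulas p q r A B C ∧
  IsC1 p q r A B C ∧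
  RangeBound p q r A B C ∧
  MainInequality p q r A B C ∧
  TangentInequality p q r A B C

end Bellman

end

/-! If u, v, w carry weights 1/p, 1/q, 1/r, every monomial in the six formulas has degree 1, so
Euler's identity recovers 𝒜 from its gradient. The gradient has a single expression on the whole
octant (`gradU`, `gradV`, `gradW`), built from maxima and minima of a = u^p, b = v^q, c = w^r;
`grad_terms` matches it with each formula on its region. Its continuity up to the boundary yields
the agreement of the formulas, the C¹ property and the extended differential.

The inequalities (B3) and (B4) rest on quantitative convexity: d²𝒜(h,h) ≥ 2u|h_v||h_w| in every
region (`hess_weighted_le`). Writing h coordinatewise as (ux, vy, wz) turns each Hessian into a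
quadratic form in x, y, z whose coefficients are multiples of the monomials. The ordering of a, b, c
bounds the off-diagonal monomials by geometric means of the diagonal ones. The constant C makes the
w-direction dominate, and A, chosen after C, makes the u-direction dominate.

Since the gradient is continuous across the interfaces, the Hessian bound can be integrated twice
along a segment. This gives `taylor`: 𝒜(z₁) exceeds its tangent plane at z by at least (2u/3 +
u₁/3)|v₁ − v||w₁ − w|. As U, V, W enter ℬ linearly, dropping u₁/3 gives (B4), and averaging over the
two endpoints around a midpoint gives (B3).

For (B2), 𝒜 ≥ 0 is `taylor` based at the origin, where 𝒜 and its gradient vanish; the upper bound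
for 𝒜 is Young's inequality in each region (`valueA_le_openOctant`). -/

noncomputable section

namespace Bellman

open Filter Topology Set

/-! ### Sums of monomials and their first two derivatives -/

/-- Linear combinations of monomials: an entry `(k, e₁, e₂, e₃)` stands for
`k * u ^ e₁ * v ^ e₂ * w ^ e₃`. -/
abbrev Terms := List (ℝ × ℝ × ℝ × ℝ)

/-- The sum of the monomials, each weighted by a function of its exponents. -/
def Terms.weighted (L : Terms) (f : ℝ × ℝ × ℝ → ℝ) (z : ℝ × ℝ × ℝ) : ℝ :=
  (L.map fun k => k.1 * (z.1 ^ k.2.1 * z.2.1 ^ k.2.2.1 * z.2.2 ^ k.2.2.2) * f k.2).sum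

/-- The sum of the monomials. -/
def Terms.eval (L : Terms) (z : ℝ × ℝ × ℝ) : ℝ := L.weighted (fun _ => 1) z

/-- The linear functional with the given coordinates. -/
def covector (g : ℝ × ℝ × ℝ) : ℝ × ℝ × ℝ →L[ℝ] ℝ :=
  g.1 • ContinuousLinearMap.fst ℝ ℝ (ℝ × ℝ)
    + g.2.1 • (ContinuousLinearMap.fst ℝ ℝ ℝ).comp (ContinuousLinearMap.snd ℝ ℝ (ℝ × ℝ))
    + g.2.2 • (ContinuousLinearMap.snd ℝ ℝ ℝ).comp (ContinuousLinearMap.snd ℝ ℝ (ℝ × ℝ))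

@[simp] lemma covector_apply (g h : ℝ × ℝ × ℝ) :
    covector g h = g.1 * h.1 + g.2.1 * h.2.1 + g.2.2 * h.2.2 := by
  simp [covector]

/-- The gradient of a sum of monomials at a point of the open octant. -/
def Terms.grad (L : Terms) (z : ℝ × ℝ × ℝ) : ℝ × ℝ × ℝ :=
  (L.weighted (fun e => e.1) z / z.1, L.weighted (fun e => e.2.1) z / z.2.1,
    L.weighted (fun e => e.2.2) z / z.2.2)

/-- The quadratic form which is multiplied by the monomial in its second derivative. -/
def logHess (x e : ℝ × ℝ × ℝ) : ℝ :=
  (e.1 * x.1 + e.2.1 * x.2.1 + e.2.2 * x.2.2) ^ 2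
    - (e.1 * x.1 ^ 2 + e.2.1 * x.2.1 ^ 2 + e.2.2 * x.2.2 ^ 2)

lemma Terms.weighted_nil (f : ℝ × ℝ × ℝ → ℝ) (z : ℝ × ℝ × ℝ) :
    Terms.weighted [] f z = 0 := by simp [Terms.weighted]

lemma Terms.weighted_cons (k : ℝ × ℝ × ℝ × ℝ) (L : Terms) (f : ℝ × ℝ × ℝ → ℝ)
    (z : ℝ × ℝ × ℝ) : Terms.weighted (k :: L) f z =
      k.1 * (z.1 ^ k.2.1 * z.2.1 ^ k.2.2.1 * z.2.2 ^ k.2.2.2) * f k.2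
        + Terms.weighted L f z := by
  simp [Terms.weighted]

lemma hasFDerivAt_monomial (e : ℝ × ℝ × ℝ) {z : ℝ × ℝ × ℝ} (hz : z ∈ openOctant) :
    HasFDerivAt (fun z : ℝ × ℝ × ℝ => z.1 ^ e.1 * z.2.1 ^ e.2.1 * z.2.2 ^ e.2.2)
      ((z.1 ^ e.1 * z.2.1 ^ e.2.1 * z.2.2 ^ e.2.2) •
        covector (e.1 / z.1, e.2.1 / z.2.1, e.2.2 / z.2.2)) z := by
  obtain ⟨h1, h2, h3⟩ := hz
  have d1 : HasFDerivAt (fun z : ℝ × ℝ × ℝ => z.1)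
      (ContinuousLinearMap.fst ℝ ℝ (ℝ × ℝ)) z := hasFDerivAt_fst
  have d0 : HasFDerivAt (fun z : ℝ × ℝ × ℝ => z.2)
      (ContinuousLinearMap.snd ℝ ℝ (ℝ × ℝ)) z := hasFDerivAt_snd
  have d2 := d0.fst
  have d3 := d0.snd
  have := ((d1.rpow_const (p := e.1) (Or.inl h1.ne')).mul
    (d2.rpow_const (p := e.2.1) (Or.inl h2.ne'))).mul
    (d3.rpow_const (p := e.2.2) (Or.inl h3.ne'))
  refine this.congr_fderiv ?_
  refine ContinuousLinearMap.ext fun h => ?_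
  simp only [Pi.mul_apply, add_apply, smul_apply,
    ContinuousLinearMap.comp_apply, smul_eq_mul, covector_apply, ContinuousLinearMap.coe_fst',
    ContinuousLinearMap.coe_snd']
  rw [Real.rpow_sub_one h1.ne', Real.rpow_sub_one h2.ne', Real.rpow_sub_one h3.ne']
  field_simp
  ring

lemma Terms.hasFDerivAt_eval (L : Terms) {z : ℝ × ℝ × ℝ} (hz : z ∈ openOctant) :
    HasFDerivAt L.eval (covector (L.grad z)) z := by
  induction L with
  | nil =>
    have : Terms.eval [] = fun _ => (0 : ℝ) := by
      funext z; simp [Terms.eval, Terms.weighted]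
    rw [this]
    refine (hasFDerivAt_const (0 : ℝ) z).congr_fderiv ?_
    ext <;> simp [Terms.grad, Terms.weighted]
  | cons k L ih =>
    have : Terms.eval (k :: L) =
        fun z => k.1 * (z.1 ^ k.2.1 * z.2.1 ^ k.2.2.1 * z.2.2 ^ k.2.2.2) + Terms.eval L z := by
      funext z; simp [Terms.eval, Terms.weighted_cons]
    rw [this]
    refine (((hasFDerivAt_monomial k.2 hz).const_mul k.1).add ih).congr_fderiv ?_
    refine ContinuousLinearMap.ext fun h => ?_
    simp only [add_apply, smul_apply, smul_eq_mul,
      covector_apply, Terms.grad, Terms.weighted_cons]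
    ring

/-- Differentiating a monomial in direction h multiplies it by Σ eᵢhᵢ/zᵢ. Doing so twice gives the
square of that sum, minus Σ eᵢ(hᵢ/zᵢ)² from differentiating the factors 1/zᵢ; hence `logHess`
evaluated at h/z. -/
lemma Terms.hasDerivAt_grad (L : Terms) (z h : ℝ × ℝ × ℝ) (t : ℝ)
    (hz : z + t • h ∈ openOctant) :
    HasDerivAt (fun s : ℝ => covector (L.grad (z + s • h)) h)
      (L.weighted (logHess (h.1 / (z + t • h).1, h.2.1 / (z + t • h).2.1,
        h.2.2 / (z + t • h).2.2)) (z + t • h)) t := by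
  have hl : HasDerivAt (fun s : ℝ => z + s • h) h t := by
    simpa using ((hasDerivAt_id t).smul_const h).const_add z
  induction L with
  | nil =>
    simp only [Terms.grad, Terms.weighted_nil, covector_apply]
    simpa using hasDerivAt_const t (0 : ℝ)
  | cons k L ih =>
    obtain ⟨h1, h2, h3⟩ := hz
    have hm := (hasFDerivAt_monomial k.2 ⟨h1, h2, h3⟩).comp_hasDerivAt t hl
    have l1 : HasDerivAt (fun s : ℝ => (z + s • h).1) h.1 t := hl.fst
    have l2 : HasDerivAt (fun s : ℝ => (z + s • h).2.1) h.2.1 t := hl.snd.fst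
    have l3 : HasDerivAt (fun s : ℝ => (z + s • h).2.2) h.2.2 t := hl.snd.snd
    have i1 := (l1.inv h1.ne').const_mul (k.2.1 * h.1)
    have i2 := (l2.inv h2.ne').const_mul (k.2.2.1 * h.2.1)
    have i3 := (l3.inv h3.ne').const_mul (k.2.2.2 * h.2.2)
    have key := ((hm.mul ((i1.add i2).add i3)).const_mul k.1).add ih
    refine (key.congr_deriv ?_).congr_of_eventuallyEq (Eventually.of_forall fun s => ?_)
    · simp only [Terms.weighted_cons, logHess, smul_apply, covector_apply,
        smul_eq_mul, Function.comp_apply, Pi.add_apply, Pi.inv_apply]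
      field_simp
      ring
    · simp only [covector_apply, Terms.grad, Terms.weighted_cons, Function.comp_apply,
        Pi.add_apply, Pi.mul_apply, Pi.inv_apply, div_eq_mul_inv]
      ring

/-- Euler's identity with weights P, Q, R, in degree 1. -/
lemma Terms.eval_eq_of_homogeneous (L : Terms) {P Q R : ℝ}
    (hL : ∀ k ∈ L, k.2.1 * P + k.2.2.1 * Q + k.2.2.2 * R = 1) {z : ℝ × ℝ × ℝ}
    (hz : z ∈ openOctant) :
    L.eval z = P * (z.1 * (L.grad z).1) + Q * (z.2.1 * (L.grad z).2.1)
      + R * (z.2.2 * (L.grad z).2.2) := by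
  obtain ⟨h1, h2, h3⟩ := hz
  simp only [Terms.grad, mul_div_cancel₀ _ h1.ne', mul_div_cancel₀ _ h2.ne',
    mul_div_cancel₀ _ h3.ne', Terms.eval]
  induction L with
  | nil => simp [Terms.weighted_nil]
  | cons k L ih =>
    have hk := hL k (by simp)
    have := ih fun k hk => hL k (by simp [hk])
    simp only [Terms.weighted_cons, this]
    linear_combination
      (-(k.1 * (z.1 ^ k.2.1 * z.2.1 ^ k.2.2.1 * z.2.2 ^ k.2.2.2))) * hk

/-! ### Integrating a derivative bound across finitely many closed pieces -/

/-- A continuous function on `[a, b]` which on each of finitely many closed sets covering the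
interval coincides with a function whose derivative is at least that of `b` grows at least as
fast as `b`. -/
lemma sub_le_sub_of_piecewise_deriv {ι : Type*} [Finite ι] {f b b' : ℝ → ℝ} {x y : ℝ}
    (hf : ContinuousOn f (Icc x y)) (hb : ∀ t, HasDerivAt b (b' t) t)
    (S : ι → Set ℝ) (hS : ∀ i, IsClosed (S i)) (hcov : ∀ t ∈ Icc x y, ∃ i, t ∈ S i)
    (D D' : ι → ℝ → ℝ) (hD : ∀ i, ∀ t ∈ Icc x y, HasDerivAt (D i) (D' i t) t)
    (hfD : ∀ i, ∀ t ∈ Icc x y, t ∈ S i → f t = D i t)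
    (hle : ∀ i, ∀ t ∈ Icc x y, t ∈ S i → b' t ≤ D' i t) :
    ∀ t ∈ Icc x y, b t - b x ≤ f t - f x := by
  intro t ht
  have hbc : Continuous b := continuous_iff_continuousAt.2 fun t => (hb t).continuousAt
  -- This criterion only asks that slopes to the right be small frequently, not eventually, so the
  -- pieces may alternate infinitely often near a point.
  have key := image_le_of_liminf_slope_right_le_deriv_boundary (f := fun t => - f t)
    (B := fun t => - b t + (b x - f x)) (B' := fun t => - b' t) hf.neg (by simp)
    (by fun_prop)
    (fun s _ => by simpa using (((hb s).neg).add_const (b x - f x)).hasDerivWithinAt) ?_ ht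
  · linarith
  intro s hs r hr
  have hsI : s ∈ Icc x y := ⟨hs.1, hs.2.le⟩
  have hnear : ∀ᶠ z in 𝓝[>] s, z ∈ Icc x y := by
    filter_upwards [Ioo_mem_nhdsGT hs.2] with z hz using ⟨hs.1.trans hz.1.le, hz.2.le⟩
  -- Pigeonhole: one of the finitely many pieces contains points arbitrarily close to s on the
  -- right. Being closed it contains s, so there the slopes of f are slopes of a single `D i`.
  have : ∃ᶠ z in 𝓝[>] s, ∃ i, z ∈ S i ∩ Icc x y :=
    (hnear.mono fun z hz => (hcov z hz).imp fun i hi => ⟨hi, hz⟩).frequently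
  obtain ⟨i, hi⟩ : ∃ i, ∃ᶠ z in 𝓝[>] s, z ∈ S i ∩ Icc x y := by
    by_contra hcon
    push Not at hcon
    refine this ?_
    have := eventually_all.2 hcon
    exact this.mono fun z hz ⟨i, hi⟩ => hz i hi
  have hsi : s ∈ S i :=
    (hS i).mem_of_frequently_of_tendsto (hi.mono fun z hz => hz.1)
      (tendsto_id.mono_left nhdsWithin_le_nhds)
  have hslope : Tendsto (slope (fun t => - D i t) s) (𝓝[>] s) (𝓝 (- D' i s)) :=
    (hasDerivAt_iff_tendsto_slope.1 (hD i s hsI).neg).mono_left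
      (nhdsWithin_mono _ fun z hz => ne_of_gt hz)
  have hlt : - D' i s < r := lt_of_le_of_lt (neg_le_neg (hle i s hsI hsi)) hr
  refine (hi.and_eventually (hslope.eventually_lt_const hlt)).mono ?_
  rintro z ⟨⟨hzS, hzI⟩, hz⟩
  simpa only [slope_def_field, hfD i z hzI hzS, hfD i s hsI hsi] using hz

/-! ### The six formulas and the closed form of the gradient -/

/-- The monomials of the six formulas. -/
def terms (p q r A B C : ℝ) : Fin 6 → Terms
  | 0 => [(A, p, 0, 0), (B, 0, q, 0), (C, 0, 0, r)]
  | 1 => [((A * (p - 1) - C) / (p - 1), p, 0, 0), (B, 0, q, 0),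
      (C * p / (p - 1), 1, 0, r - r / p)]
  | 2 => [((A * (p - 1) - (B + C)) / (p - 1), p, 0, 0), (B * p / (p - 1), 1, q - q / p, 0),
      (C * p / (p - 1), 1, 0, r - r / p)]
  | 3 => [((A * (p - 1) - (B + C)) / (p - 1), p, 0, 0), (B * q / 2, 1, 2, 1 - r / q),
      ((2 * C * p * r - B * p * (q - r)) / (2 * r * (p - 1)), 1, 0, r - r / p)]
  | 4 => [((2 * A * r * (p - 1) - B * (q + r)) / (2 * r * (p - 1)), p, 0, 0),
      (B * q ^ 2 / (2 * p * (q - 2)), p - 2 * p / q, 2, 0),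
      (B * q * (q - r) / (2 * r * (q - 2)), 0, 2, r - 2 * r / q),
      ((2 * C * r - B * (q - r)) / (2 * r), 0, 0, r)]
  | 5 => [(A, p, 0, 0), (B * q / (p * (q - 2)), 0, q, 0),
      (B * q * (q - r) / (2 * r * (q - 2)), 0, 2, r - 2 * r / q),
      ((2 * C * r - B * (q - r)) / (2 * r), 0, 0, r)]

/-- The six orderings of `(a, b, c) = (u ^ p, v ^ q, w ^ r)`. -/
def Ordering (a b c : ℝ) : Fin 6 → Prop
  | 0 => a ≤ c ∧ c ≤ b
  | 1 => c ≤ a ∧ a ≤ b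
  | 2 => c ≤ b ∧ b ≤ a
  | 3 => b ≤ c ∧ c ≤ a
  | 4 => b ≤ a ∧ a ≤ c
  | 5 => a ≤ b ∧ b ≤ c

lemma exists_ordering (a b c : ℝ) : ∃ i, Ordering a b c i := by
  rcases le_total a b with h1 | h1 <;> rcases le_total b c with h2 | h2 <;>
    rcases le_total a c with h3 | h3
  · exact ⟨5, h1, h2⟩
  · exact ⟨5, h1, h2⟩
  · exact ⟨0, h3, h2⟩
  · exact ⟨1, h3, h1⟩
  · exact ⟨4, h1, h3⟩
  · exact ⟨3, h2, h3⟩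
  · exact ⟨2, h2, h1⟩
  · exact ⟨2, h2, h1⟩

/-- The exponents `1 < p, q, r` with `r < q` and `1 / p + 1 / q + 1 / r = 1`. -/
structure Exponents (p q r : ℝ) : Prop where
  one_lt_p : 1 < p
  one_lt_q : 1 < q
  one_lt_r : 1 < r
  r_lt_q : r < q
  sum_eq : 1 / p + 1 / q + 1 / r = 1

/-- The partial derivative of `𝒜` in `u`, in terms of `(a, b, c) = (u ^ p, v ^ q, w ^ r)`. -/
def gradU (p q r A B C a b c : ℝ) : ℝ :=
  A * p * a ^ (1 - 1 / p)
    + B * (-(p / (p - 1)) * max a b ^ (1 - 1 / p)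
      + q / 2 * (b ^ (2 / q) * max b (min a c) ^ (1 / r - 1 / q))
      - p * (q - r) / (2 * r * (p - 1)) * max b (min a c) ^ (1 - 1 / p))
    - C * p / (p - 1) * (max a c ^ (1 - 1 / p) - c ^ (1 - 1 / p))

/-- The partial derivative of `𝒜` in `v`, in terms of `(a, b, c) = (u ^ p, v ^ q, w ^ r)`. -/
def gradV (p q r B a b c : ℝ) : ℝ :=
  B * q * b ^ (1 / q) * (max a b ^ (1 / p) * max b (min a c) ^ (1 / r - 1 / q)
    + (q - r) / (r * (q - 2)) * (max b c ^ (1 - 2 / q) - max b (min a c) ^ (1 - 2 / q)))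

/-- The partial derivative of `𝒜` in `w`, in terms of `(a, b, c) = (u ^ p, v ^ q, w ^ r)`. -/
def gradW (p q r B C a b c : ℝ) : ℝ :=
  ((C * r - B * (q - r) / 2) * c ^ (1 / q)
    + B * (q - r) / 2 * (min b c ^ (2 / q) * c ^ (-(1 / q)))) * max a c ^ (1 / p)

/-- The gradient of `𝒜`. -/
def gradA (p q r A B C : ℝ) (z : ℝ × ℝ × ℝ) : ℝ × ℝ × ℝ :=
  (gradU p q r A B C (z.1 ^ p) (z.2.1 ^ q) (z.2.2 ^ r),
    gradV p q r B (z.1 ^ p) (z.2.1 ^ q) (z.2.2 ^ r),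
    gradW p q r B C (z.1 ^ p) (z.2.1 ^ q) (z.2.2 ^ r))

namespace Exponents
variable {p q r : ℝ}

lemma two_lt_q (h : Exponents p q r) : 2 < q := by
  have h1 : 0 < 1 / p := one_div_pos.2 (by linarith [h.one_lt_p])
  have h2 : 1 / q < 1 / r := one_div_lt_one_div_of_lt (by linarith [h.one_lt_r]) h.r_lt_q
  have h3 := h.sum_eq
  have h4 : 1 / q < 1 / 2 := by linarith
  exact lt_of_one_div_lt_one_div (by linarith [h.one_lt_q]) h4

lemma one_div_p (h : Exponents p q r) : 1 / p = 1 - 1 / q - 1 / r := by linarith [h.sum_eq]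

/-- This form of the exponent relation lets p be eliminated rationally in favour of q and r in the
algebraic identities below. -/
lemma mul_denom (h : Exponents p q r) : p * (q * r - q - r) = q * r := by
  have hp : p ≠ 0 := by linarith [h.one_lt_p]
  have hq : q ≠ 0 := by linarith [h.one_lt_q]
  have hr : r ≠ 0 := by linarith [h.one_lt_r]
  have := h.one_div_p
  field_simp at this
  linear_combination -this

lemma denom_pos (h : Exponents p q r) : 0 < q * r - q - r := by
  have hp := h.one_lt_p
  have hq := h.one_lt_q
  have hr := h.one_lt_r
  have : 0 < q * r := by positivity
  rw [← h.mul_denom] at this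
  exact pos_of_mul_pos_right this (by linarith)

lemma p_eq (h : Exponents p q r) : p = q * r / (q * r - q - r) := by
  rw [eq_div_iff h.denom_pos.ne', h.mul_denom]

lemma p_sub_one (h : Exponents p q r) : p - 1 = (q + r) / (q * r - q - r) := by
  rw [eq_div_iff h.denom_pos.ne']
  linear_combination h.mul_denom

end Exponents

lemma terms_homogeneous {p q r : ℝ} (h : Exponents p q r) (A B C : ℝ) (i : Fin 6) :
    ∀ k ∈ terms p q r A B C i,
      k.2.1 * (1 / p) + k.2.2.1 * (1 / q) + k.2.2.2 * (1 / r) = 1 := by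
  have hp : p ≠ 0 := by linarith [h.one_lt_p]
  have hq : q ≠ 0 := by linarith [h.one_lt_q]
  have hr : r ≠ 0 := by linarith [h.one_lt_r]
  have e0 : p * (1 / p) = 1 := by field_simp
  have e1 : q * (1 / q) = 1 := by field_simp
  have e2 : r * (1 / r) = 1 := by field_simp
  have e3 : 1 * (1 / p) + (r - r / p) * (1 / r) = 1 := by field_simp; ring
  have e4 : 1 * (1 / p) + (q - q / p) * (1 / q) = 1 := by field_simp; ring
  have e5 : 1 * (1 / p) + 2 * (1 / q) + (1 - r / q) * (1 / r) = 1 := by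
    rw [h.one_div_p]; field_simp; ring
  have e6 : (p - 2 * p / q) * (1 / p) + 2 * (1 / q) = 1 := by field_simp; ring
  have e7 : 2 * (1 / q) + (r - 2 * r / q) * (1 / r) = 1 := by field_simp; ring
  fin_cases i <;> simp only [terms, List.forall_mem_cons, zero_mul, add_zero, zero_add,
    e0, e1, e2, e3, e4, e5, e6, e7, List.not_mem_nil, false_imp_iff, implies_true, and_self]

/-- The powers of `a` occurring in the formulas, in terms of three of them. -/
lemma rpow_relations {p q r : ℝ} (h : Exponents p q r) {a : ℝ} (ha : 0 < a) :
    a = a ^ (1 / p) * a ^ (1 / q) * a ^ (1 / r) ∧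
    a ^ (1 - 1 / p) = a ^ (1 / q) * a ^ (1 / r) ∧
    a ^ (2 / q) = (a ^ (1 / q)) ^ 2 ∧
    a ^ (1 / r - 1 / q) = a ^ (1 / r) / a ^ (1 / q) ∧
    a ^ (1 - 2 / q) = a ^ (1 / p) * a ^ (1 / r) / a ^ (1 / q) ∧
    a ^ (-(1 / q)) = 1 / a ^ (1 / q) := by
  have hs := h.sum_eq
  refine ⟨?_, ?_, ?_, ?_, ?_, ?_⟩
  · rw [← Real.rpow_add ha, ← Real.rpow_add ha, hs, Real.rpow_one]
  · rw [← Real.rpow_add ha]; congr 1; linarith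
  · rw [← Real.rpow_natCast, ← Real.rpow_mul ha.le]; congr 1; push_cast; ring
  · rw [← Real.rpow_sub ha]
  · rw [← Real.rpow_add ha, ← Real.rpow_sub ha]; congr 1; linear_combination -hs
  · rw [Real.rpow_neg ha.le, inv_eq_one_div]

lemma rpow_relations_u {p q r : ℝ} (h : Exponents p q r) {u : ℝ} (hu : 0 < u) :
    (u ^ p) ^ (1 / p) = u ∧
    u ^ (p - 2 * p / q) = (u ^ p) ^ (1 / p) * (u ^ p) ^ (1 / r) / (u ^ p) ^ (1 / q) := by
  have hp : p ≠ 0 := by linarith [h.one_lt_p]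
  refine ⟨?_, ?_⟩
  · rw [← Real.rpow_mul hu.le, mul_one_div_cancel hp, Real.rpow_one]
  · rw [← (rpow_relations h (Real.rpow_pos_of_pos hu p)).2.2.2.2.1, ← Real.rpow_mul hu.le]
    congr 1; ring

lemma rpow_relations_v {p q r : ℝ} (h : Exponents p q r) {v : ℝ} (hv : 0 < v) :
    (v ^ q) ^ (1 / q) = v ∧
    v ^ (q - q / p) = (v ^ q) ^ (1 / q) * (v ^ q) ^ (1 / r) := by
  have hq : q ≠ 0 := by linarith [h.one_lt_q]
  refine ⟨?_, ?_⟩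
  · rw [← Real.rpow_mul hv.le, mul_one_div_cancel hq, Real.rpow_one]
  · rw [← (rpow_relations h (Real.rpow_pos_of_pos hv q)).2.1, ← Real.rpow_mul hv.le]
    congr 1; ring

lemma rpow_relations_w {p q r : ℝ} (h : Exponents p q r) {w : ℝ} (hw : 0 < w) :
    (w ^ r) ^ (1 / r) = w ∧
    w ^ (r - r / p) = (w ^ r) ^ (1 / q) * (w ^ r) ^ (1 / r) ∧
    w ^ (1 - r / q) = (w ^ r) ^ (1 / r) / (w ^ r) ^ (1 / q) ∧
    w ^ (r - 2 * r / q) = (w ^ r) ^ (1 / p) * (w ^ r) ^ (1 / r) / (w ^ r) ^ (1 / q) := by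
  have hr : r ≠ 0 := by linarith [h.one_lt_r]
  have hc := rpow_relations h (Real.rpow_pos_of_pos hw r)
  refine ⟨?_, ?_, ?_, ?_⟩
  · rw [← Real.rpow_mul hw.le, mul_one_div_cancel hr, Real.rpow_one]
  · rw [← hc.2.1, ← Real.rpow_mul hw.le]
    congr 1; ring
  · rw [← hc.2.2.2.1, ← Real.rpow_mul hw.le]
    congr 1; field_simp
  · rw [← hc.2.2.2.2.1, ← Real.rpow_mul hw.le]
    congr 1; ring

/-- On each region the gradient of the formula is the global gradient. -/
lemma grad_terms {p q r : ℝ} (h : Exponents p q r) (A B C : ℝ) (i : Fin 6) {z : ℝ × ℝ × ℝ}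
    (hz : z ∈ openOctant) (hi : Ordering (z.1 ^ p) (z.2.1 ^ q) (z.2.2 ^ r) i) :
    (terms p q r A B C i).grad z = gradA p q r A B C z := by
  obtain ⟨u, v, w⟩ := z
  obtain ⟨hu, hv, hw⟩ := hz
  simp only at hu hv hw hi
  have hau := rpow_relations_u h hu
  have hbv := rpow_relations_v h hv
  have hcw := rpow_relations_w h hw
  have ha := Real.rpow_pos_of_pos hu p
  have hb := Real.rpow_pos_of_pos hv q
  have hc := Real.rpow_pos_of_pos hw r
  simp only [gradA, Terms.grad]
  set a := u ^ p with ha'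
  set b := v ^ q with hb'
  set c := w ^ r with hc'
  obtain ⟨a1, a2, a3, a4, a5, -⟩ := rpow_relations h ha
  obtain ⟨b1, b2, b3, b4, b5, -⟩ := rpow_relations h hb
  obtain ⟨c1, c2, c3, c4, c5, c6⟩ := rpow_relations h hc
  have aP := Real.rpow_pos_of_pos ha (1 / p)
  have aQ := Real.rpow_pos_of_pos ha (1 / q)
  have aR := Real.rpow_pos_of_pos ha (1 / r)
  have bP := Real.rpow_pos_of_pos hb (1 / p)
  have bQ := Real.rpow_pos_of_pos hb (1 / q)
  have bR := Real.rpow_pos_of_pos hb (1 / r)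
  have cP := Real.rpow_pos_of_pos hc (1 / p)
  have cQ := Real.rpow_pos_of_pos hc (1 / q)
  have cR := Real.rpow_pos_of_pos hc (1 / r)
  obtain ⟨u1, u2⟩ := hau
  obtain ⟨v1, v2⟩ := hbv
  obtain ⟨w1, w2, w3, w4⟩ := hcw
  have hd := h.denom_pos
  have hq2 : 0 < q - 2 := by linarith [h.two_lt_q]
  have hq0 : 0 < q := by linarith
  have hr0 : 0 < r := by linarith [h.one_lt_r]
  have hqr : 0 < q + r := by linarith
  have hpe := h.p_eq
  have hp1 := h.p_sub_one
  clear_value a b c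
  -- The common denominator of p and p − 1 is kept as a single positive atom while fractions are
  -- cleared; its value is restored before `ring`.
  obtain ⟨d, hde⟩ : ∃ d, d = q * r - q - r := ⟨_, rfl⟩
  rw [← hde] at hd hpe hp1
  have hgoal : ∀ X Y Z X' Y' Z' : ℝ, X = u * X' → Y = v * Y' → Z = w * Z' →
      (X / u, Y / v, Z / w) = (X', Y', Z') := by
    intro X Y Z X' Y' Z' e1 e2 e3
    rw [e1, e2, e3, mul_div_cancel_left₀ _ hu.ne', mul_div_cancel_left₀ _ hv.ne',
      mul_div_cancel_left₀ _ hw.ne']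
  apply hgoal <;> clear hgoal <;> fin_cases i <;>
    simp only [Ordering] at hi <;> obtain ⟨hi1, hi2⟩ := hi <;> have hi3 := hi1.trans hi2 <;>
    simp only [terms, Terms.weighted_cons, Terms.weighted_nil, gradU, gradV, gradW,
      max_eq_left, max_eq_right, min_eq_left, min_eq_right, hi1, hi2, hi3, Real.rpow_zero,
      Real.rpow_one, Real.rpow_two, u2, v2, w2, w3, w4, a2, a4, a5, b2, b3, b4, b5, c2,
      c3, c4, c5, c6, hp1, ← ha', ← hb', ← hc']
  -- All powers are now rational in x^(1/p), x^(1/q), x^(1/r) for x = a, b, c, and u, v, w are three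
  -- of these nine numbers. Treating them as independent positive variables leaves rational
  -- identities.
  all_goals
    clear u2 v2 w2 w3 w4 a2 a3 a4 a5 b2 b3 b4 b5 c2 c3 c4 c5 c6 hi1 hi2 hi3 ha' hb' hc'
    simp only [u1, v1, w1] at *
    clear u1 v1 w1
    generalize a ^ (1 / q) = a₂ at *
    generalize a ^ (1 / r) = a₃ at *
    generalize b ^ (1 / p) = b₁ at *
    generalize b ^ (1 / r) = b₃ at *
    generalize c ^ (1 / p) = c₁ at *
    generalize c ^ (1 / q) = c₂ at *
    subst a1 b1 c1
    clear h hp1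
    subst hpe
    clear ha hb hc
    have hq2' := hq2.ne'
    field_simp
    try simp only [hde]
    try ring

namespace Exponents
variable {p q r : ℝ}

lemma p_pos (h : Exponents p q r) : 0 < p := by linarith [h.one_lt_p]
lemma q_pos (h : Exponents p q r) : 0 < q := by linarith [h.one_lt_q]
lemma r_pos (h : Exponents p q r) : 0 < r := by linarith [h.one_lt_r]

lemma one_sub_one_div_p_pos (h : Exponents p q r) : 0 < 1 - 1 / p := by
  have := h.sum_eq
  have := one_div_pos.2 h.q_pos
  have := one_div_pos.2 h.r_pos
  linarith

lemma one_div_q_lt (h : Exponents p q r) : 1 / q < 1 / r :=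
  one_div_lt_one_div_of_lt h.r_pos h.r_lt_q

lemma one_sub_two_div_q_pos (h : Exponents p q r) : 0 < 1 - 2 / q := by
  have := (div_lt_one h.q_pos).2 h.two_lt_q
  linarith

end Exponents

/-! ### Extension of the gradient and of the values to the boundary -/

lemma openOctant_subset : openOctant ⊆ closedOctant := fun _ hz =>
  ⟨hz.1.le, hz.2.1.le, hz.2.2.le⟩

lemma isOpen_openOctant : IsOpen openOctant := by
  have h1 : IsOpen {z : ℝ × ℝ × ℝ | 0 < z.1} := isOpen_lt continuous_const (by fun_prop)
  have h2 : IsOpen {z : ℝ × ℝ × ℝ | 0 < z.2.1} := isOpen_lt continuous_const (by fun_prop)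
  have h3 : IsOpen {z : ℝ × ℝ × ℝ | 0 < z.2.2} := isOpen_lt continuous_const (by fun_prop)
  exact h1.inter (h2.inter h3)

lemma add_smul_one_mem_openOctant {z : ℝ × ℝ × ℝ} (hz : z ∈ closedOctant) {ε : ℝ}
    (hε : 0 < ε) : z + ε • (1, 1, 1) ∈ openOctant := by
  obtain ⟨h1, h2, h3⟩ := hz
  refine ⟨?_, ?_, ?_⟩ <;> simp <;> linarith

lemma tendsto_add_smul_one (z : ℝ × ℝ × ℝ) :
    Tendsto (fun ε : ℝ => z + ε • ((1 : ℝ), (1 : ℝ), (1 : ℝ))) (𝓝[>] 0) (𝓝 z) := by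
  have : Continuous fun ε : ℝ => z + ε • ((1 : ℝ), (1 : ℝ), (1 : ℝ)) := by fun_prop
  simpa using (this.tendsto 0).mono_left nhdsWithin_le_nhds

/-- Approximation of a point of the closed octant by points of the open octant. -/
lemma tendsto_add_smul_one_openOctant {z : ℝ × ℝ × ℝ} (hz : z ∈ closedOctant) :
    Tendsto (fun ε : ℝ => z + ε • ((1 : ℝ), (1 : ℝ), (1 : ℝ))) (𝓝[>] 0) (𝓝[openOctant] z) :=
  tendsto_nhdsWithin_iff.2 ⟨tendsto_add_smul_one z,
    eventually_nhdsWithin_of_forall fun _ hε => add_smul_one_mem_openOctant hz hε⟩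

lemma closedOctant_subset_closure : closedOctant ⊆ closure openOctant := fun _ hz =>
  mem_closure_iff_nhdsWithin_neBot.2 (tendsto_add_smul_one_openOctant hz).neBot

lemma continuous_gradU {X : Type*} [TopologicalSpace X] {p q r : ℝ} (h : Exponents p q r)
    (A B C : ℝ) {a b c : X → ℝ} (ha : Continuous a) (hb : Continuous b) (hc : Continuous c) :
    Continuous fun x => gradU p q r A B C (a x) (b x) (c x) := by
  have h1 := h.one_sub_one_div_p_pos.le
  have h2 : 0 ≤ 1 / r - 1 / q := by linarith [h.one_div_q_lt]
  have h3 : 0 ≤ 2 / q := by have := h.q_pos; positivity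
  unfold gradU
  fun_prop (disch := (intro _; right; assumption))

lemma continuous_gradV {X : Type*} [TopologicalSpace X] {p q r : ℝ} (h : Exponents p q r)
    (B : ℝ) {a b c : X → ℝ} (ha : Continuous a) (hb : Continuous b) (hc : Continuous c) :
    Continuous fun x => gradV p q r B (a x) (b x) (c x) := by
  have h1 := h.one_sub_two_div_q_pos.le
  have h2 : 0 ≤ 1 / r - 1 / q := by linarith [h.one_div_q_lt]
  have h3 : 0 ≤ 1 / q := by have := h.q_pos; positivity
  have h4 : 0 ≤ 1 / p := by have := h.p_pos; positivity
  unfold gradV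
  fun_prop (disch := (intro _; right; assumption))

/-- `min b c ^ (2 s) / c ^ s` is continuous up to the boundary. -/
lemma continuousOn_min_rpow_mul_rpow_neg {s : ℝ} (hs : 0 < s) :
    ContinuousOn (fun x : ℝ × ℝ => min x.1 x.2 ^ (2 * s) * x.2 ^ (-s))
      {x | 0 ≤ x.1 ∧ 0 ≤ x.2} := by
  rintro ⟨b, c⟩ ⟨hb, hc⟩
  simp only at hb hc
  -- At c = 0 the factor c^(−s) is singular, but min b c ≤ c squeezes the product between 0 and c^s.
  rcases hc.eq_or_lt with rfl | hc
  · have hz : min b 0 ^ (2 * s) * (0 : ℝ) ^ (-s) = 0 := by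
      rw [min_eq_right hb, Real.zero_rpow (by positivity), zero_mul]
    unfold ContinuousWithinAt
    simp only [hz]
    have hlim : Tendsto (fun x : ℝ × ℝ => x.2 ^ s) (𝓝[{x | 0 ≤ x.1 ∧ 0 ≤ x.2}] (b, 0))
        (𝓝 0) := by
      have : Continuous fun x : ℝ × ℝ => x.2 ^ s :=
        continuous_snd.rpow_const fun _ => Or.inr hs.le
      simpa [Real.zero_rpow hs.ne'] using (this.tendsto (b, 0)).mono_left nhdsWithin_le_nhds
    refine tendsto_of_tendsto_of_tendsto_of_le_of_le' tendsto_const_nhds hlim ?_ ?_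
    · filter_upwards [self_mem_nhdsWithin] with x hx
      have := Real.rpow_nonneg (le_min hx.1 hx.2) (2 * s)
      have := Real.rpow_nonneg hx.2 (-s)
      positivity
    · filter_upwards [self_mem_nhdsWithin] with x hx
      have hmono : min x.1 x.2 ^ (2 * s) ≤ x.2 ^ (2 * s) :=
        Real.rpow_le_rpow (le_min hx.1 hx.2) (min_le_right _ _) (by positivity)
      refine (mul_le_mul_of_nonneg_right hmono (Real.rpow_nonneg hx.2 _)).trans_eq ?_
      rw [← Real.rpow_add' hx.2 (by linarith)]
      congr 1; ring
  · refine ContinuousAt.continuousWithinAt (ContinuousAt.mul ?_ ?_)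
    · exact (Continuous.rpow_const (by fun_prop) fun _ => Or.inr (by positivity)).continuousAt
    · exact continuousAt_snd.rpow_const (Or.inl hc.ne')

lemma continuousOn_gradA {p q r : ℝ} (h : Exponents p q r) (A B C : ℝ) :
    ContinuousOn (gradA p q r A B C) closedOctant := by
  have ha : Continuous fun z : ℝ × ℝ × ℝ => z.1 ^ p :=
    continuous_fst.rpow_const fun _ => Or.inr h.p_pos.le
  have hb : Continuous fun z : ℝ × ℝ × ℝ => z.2.1 ^ q :=
    (Continuous.rpow_const (by fun_prop) fun _ => Or.inr h.q_pos.le)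
  have hc : Continuous fun z : ℝ × ℝ × ℝ => z.2.2 ^ r :=
    (Continuous.rpow_const (by fun_prop) fun _ => Or.inr h.r_pos.le)
  have h1 : 0 ≤ 1 / p := (one_div_pos.2 h.p_pos).le
  have h2 : 0 < 1 / q := one_div_pos.2 h.q_pos
  refine (continuous_gradU h A B C ha hb hc).continuousOn.prodMk
    ((continuous_gradV h B ha hb hc).continuousOn.prodMk ?_)
  have hk : ContinuousOn (fun z : ℝ × ℝ × ℝ =>
      min (z.2.1 ^ q) (z.2.2 ^ r) ^ (2 / q) * (z.2.2 ^ r) ^ (-(1 / q))) closedOctant := by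
    have := (continuousOn_min_rpow_mul_rpow_neg h2).comp (hb.prodMk hc).continuousOn
      (s := closedOctant) fun z hz =>
        ⟨Real.rpow_nonneg hz.2.1 q, Real.rpow_nonneg hz.2.2 r⟩
    simpa only [mul_one_div, Function.comp_def] using this
  unfold gradW
  refine ContinuousOn.mul (ContinuousOn.add ?_ (continuousOn_const.mul hk)) ?_
  · exact (continuous_const.mul (hc.rpow_const fun _ => Or.inr h2.le)).continuousOn
  · exact ((ha.max hc).rpow_const fun _ => Or.inr h1).continuousOn

/-- `𝒜`, recovered from its gradient by Euler's identity. -/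
def valueA (p q r A B C : ℝ) (z : ℝ × ℝ × ℝ) : ℝ :=
  1 / p * (z.1 * (gradA p q r A B C z).1) + 1 / q * (z.2.1 * (gradA p q r A B C z).2.1)
    + 1 / r * (z.2.2 * (gradA p q r A B C z).2.2)

lemma continuousOn_valueA {p q r : ℝ} (h : Exponents p q r) (A B C : ℝ) :
    ContinuousOn (valueA p q r A B C) closedOctant := by
  have := continuousOn_gradA h A B C
  unfold valueA
  generalize gradA p q r A B C = g at this ⊢
  fun_prop

lemma eval_terms_of_mem_openOctant {p q r : ℝ} (h : Exponents p q r) (A B C : ℝ) (i : Fin 6)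
    {z : ℝ × ℝ × ℝ} (hz : z ∈ openOctant)
    (hi : Ordering (z.1 ^ p) (z.2.1 ^ q) (z.2.2 ^ r) i) :
    (terms p q r A B C i).eval z = valueA p q r A B C z := by
  rw [Terms.eval_eq_of_homogeneous _ (terms_homogeneous h A B C i) hz, grad_terms h A B C i hz hi,
    valueA]

lemma Terms.continuous_eval {L : Terms}
    (hL : ∀ k ∈ L, 0 ≤ k.2.1 ∧ 0 ≤ k.2.2.1 ∧ 0 ≤ k.2.2.2) : Continuous L.eval := by
  induction L with
  | nil =>
    have : Terms.eval [] = fun _ => (0 : ℝ) := by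
      funext z; simp [Terms.eval, Terms.weighted]
    rw [this]
    exact continuous_const
  | cons k L ih =>
    have : Terms.eval (k :: L) =
        fun z => k.1 * (z.1 ^ k.2.1 * z.2.1 ^ k.2.2.1 * z.2.2 ^ k.2.2.2) + Terms.eval L z := by
      funext z; simp [Terms.eval, Terms.weighted_cons]
    rw [this]
    have hih := ih fun k hk => hL k (by simp [hk])
    obtain ⟨h1, h2, h3⟩ := hL k (by simp)
    fun_prop (disch := (intro _; right; assumption))

lemma continuous_eval_terms {p q r : ℝ} (h : Exponents p q r) (A B C : ℝ) (i : Fin 6) :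
    Continuous (terms p q r A B C i).eval := by
  have hp := h.p_pos
  have hq := h.q_pos
  have hr := h.r_pos
  have e1 : 0 ≤ r - r / p := by
    have : r - r / p = r * (1 - 1 / p) := by ring
    rw [this]; exact mul_nonneg hr.le h.one_sub_one_div_p_pos.le
  have e2 : 0 ≤ q - q / p := by
    have : q - q / p = q * (1 - 1 / p) := by ring
    rw [this]; exact mul_nonneg hq.le h.one_sub_one_div_p_pos.le
  have e3 : 0 ≤ 1 - r / q := by linarith [(div_lt_one hq).2 h.r_lt_q]
  have e4 : 0 ≤ p - 2 * p / q := by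
    have : p - 2 * p / q = p * (1 - 2 / q) := by ring
    rw [this]; exact mul_nonneg hp.le h.one_sub_two_div_q_pos.le
  have e5 : 0 ≤ r - 2 * r / q := by
    have : r - 2 * r / q = r * (1 - 2 / q) := by ring
    rw [this]; exact mul_nonneg hr.le h.one_sub_two_div_q_pos.le
  apply Terms.continuous_eval
  fin_cases i <;> simp only [terms, List.forall_mem_cons, List.not_mem_nil, false_imp_iff,
    implies_true, e1, e2, e3, e4, e5, hp.le, hq.le, hr.le, le_refl, zero_le_one, zero_le_two,
    and_self]

/-- The path along which each of `u ^ p`, `v ^ q`, `w ^ r` increases at unit speed. -/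
lemma tendsto_rpow_shift {p u : ℝ} (hp : 0 < p) (hu : 0 ≤ u) :
    Tendsto (fun ε : ℝ => (u ^ p + ε) ^ (1 / p)) (𝓝[>] 0) (𝓝 u) := by
  have : Continuous fun ε : ℝ => (u ^ p + ε) ^ (1 / p) :=
    Continuous.rpow_const (by fun_prop) fun _ => Or.inr (one_div_pos.2 hp).le
  have h0 := (this.tendsto 0).mono_left (nhdsWithin_le_nhds (s := Ioi 0))
  rwa [add_zero, ← Real.rpow_mul hu, mul_one_div_cancel hp.ne', Real.rpow_one] at h0

lemma Ordering.add_right {a b c : ℝ} {i : Fin 6} (hi : Ordering a b c i) (ε : ℝ) :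
    Ordering (a + ε) (b + ε) (c + ε) i := by
  fin_cases i <;> exact ⟨add_le_add_left hi.1 ε, add_le_add_left hi.2 ε⟩

/-- Boundary points are reached by a limit inside the same region: adding ε to each of u^p, v^q, w^r
preserves their ordering and enters the open octant. Both sides are continuous there. -/
lemma eval_terms {p q r : ℝ} (h : Exponents p q r) (A B C : ℝ) (i : Fin 6)
    {z : ℝ × ℝ × ℝ} (hz : z ∈ closedOctant)
    (hi : Ordering (z.1 ^ p) (z.2.1 ^ q) (z.2.2 ^ r) i) :
    (terms p q r A B C i).eval z = valueA p q r A B C z := by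
  obtain ⟨hu, hv, hw⟩ := hz
  let ζ : ℝ → ℝ × ℝ × ℝ := fun ε =>
    ((z.1 ^ p + ε) ^ (1 / p), (z.2.1 ^ q + ε) ^ (1 / q), (z.2.2 ^ r + ε) ^ (1 / r))
  have hpow : ∀ {s x ε : ℝ}, 0 < s → 0 ≤ x → 0 < ε →
      0 < (x ^ s + ε) ^ (1 / s) ∧ ((x ^ s + ε) ^ (1 / s)) ^ s = x ^ s + ε := by
    intro s x ε hs hx hε
    have : 0 < x ^ s + ε := add_pos_of_nonneg_of_pos (Real.rpow_nonneg hx s) hε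
    exact ⟨Real.rpow_pos_of_pos this _, by
      rw [← Real.rpow_mul this.le, one_div_mul_cancel hs.ne', Real.rpow_one]⟩
  have hopen : ∀ ε > 0, ζ ε ∈ openOctant := fun ε hε =>
    ⟨(hpow h.p_pos hu hε).1, (hpow h.q_pos hv hε).1, (hpow h.r_pos hw hε).1⟩
  have hlim : Tendsto ζ (𝓝[>] 0) (𝓝 z) :=
    (tendsto_rpow_shift h.p_pos hu).prodMk_nhds
      ((tendsto_rpow_shift h.q_pos hv).prodMk_nhds (tendsto_rpow_shift h.r_pos hw))
  have hlim' : Tendsto ζ (𝓝[>] 0) (𝓝[closedOctant] z) := tendsto_nhdsWithin_iff.2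
    ⟨hlim, eventually_nhdsWithin_of_forall fun ε hε => openOctant_subset (hopen ε hε)⟩
  refine tendsto_nhds_unique
    (((continuous_eval_terms h A B C i).tendsto z).comp hlim)
    (((continuousOn_valueA h A B C z ⟨hu, hv, hw⟩).tendsto.comp hlim').congr' ?_)
  refine eventually_nhdsWithin_of_forall fun ε hε => ?_
  refine (eval_terms_of_mem_openOctant h A B C i (hopen ε hε) ?_).symm
  simp only [ζ]
  rw [(hpow h.p_pos hu hε).2, (hpow h.q_pos hv hε).2, (hpow h.r_pos hw hε).2]
  exact hi.add_right ε

/-! ### Consistency of the formulas and the C¹ property -/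

/-- The six formulas. -/
def formula (p q r A B C u v w : ℝ) : Fin 6 → ℝ
  | 0 => formula1 p q r A B C u v w
  | 1 => formula2 p q r A B C u v w
  | 2 => formula3 p q r A B C u v w
  | 3 => formula4 p q r A B C u v w
  | 4 => formula5 p q r A B C u v w
  | 5 => formula6 p q r A B C u v w

lemma formula_eq_eval (p q r A B C u v w : ℝ) (i : Fin 6) :
    formula p q r A B C u v w i = (terms p q r A B C i).eval (u, v, w) := by
  fin_cases i <;>
    simp only [formula, formula1, formula2, formula3, formula4, formula5, formula6, terms,
      Terms.eval, Terms.weighted_cons, Terms.weighted_nil, Real.rpow_zero, Real.rpow_one,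
      Real.rpow_two] <;> ring

lemma funA_eq_valueA {p q r : ℝ} (h : Exponents p q r) (A B C : ℝ) {z : ℝ × ℝ × ℝ}
    (hz : z ∈ closedOctant) : funA p q r A B C z = valueA p q r A B C z := by
  have key : ∀ i, Ordering (z.1 ^ p) (z.2.1 ^ q) (z.2.2 ^ r) i →
      formula p q r A B C z.1 z.2.1 z.2.2 i = valueA p q r A B C z := fun i hi => by
    rw [formula_eq_eval, eval_terms h A B C i hz hi]
  simp only [funA]
  split_ifs with h1 h2 h3 h4 h5
  · exact key 0 h1
  · exact key 1 h2
  · exact key 2 h3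
  · exact key 3 h4
  · exact key 4 h5
  -- The final `else` carries no condition of its own; the sixth ordering must hold because the
  -- other five have been refuted.
  · obtain ⟨i, hi⟩ := exists_ordering (z.1 ^ p) (z.2.1 ^ q) (z.2.2 ^ r)
    refine key 5 ?_
    fin_cases i
    exacts [(h1 hi).elim, (h2 hi).elim, (h3 hi).elim, (h4 hi).elim, (h5 hi).elim, hi]

lemma agreesWithFormulas {p q r : ℝ} (h : Exponents p q r) (A B C : ℝ) :
    AgreesWithFormulas p q r A B C := by
  intro u v w hu hv hw
  have key : ∀ i, Ordering (u ^ p) (v ^ q) (w ^ r) i →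
      funA p q r A B C (u, v, w) = formula p q r A B C u v w i := fun i hi => by
    have hz : (u, v, w) ∈ closedOctant := ⟨hu, hv, hw⟩
    rw [funA_eq_valueA h A B C hz, formula_eq_eval, eval_terms h A B C i hz hi]
  exact ⟨fun h1 h2 => key 0 ⟨h1, h2⟩, fun h1 h2 => key 1 ⟨h1, h2⟩, fun h1 h2 => key 2 ⟨h1, h2⟩,
    fun h1 h2 => key 3 ⟨h1, h2⟩, fun h1 h2 => key 4 ⟨h1, h2⟩, fun h1 h2 => key 5 ⟨h1, h2⟩⟩

lemma isClosed_setOf_ordering {X : Type*} [TopologicalSpace X] {a b c : X → ℝ}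
    (ha : Continuous a) (hb : Continuous b) (hc : Continuous c) (i : Fin 6) :
    IsClosed {x | Ordering (a x) (b x) (c x) i} := by
  fin_cases i
  · exact (isClosed_le ha hc).inter (isClosed_le hc hb)
  · exact (isClosed_le hc ha).inter (isClosed_le ha hb)
  · exact (isClosed_le hc hb).inter (isClosed_le hb ha)
  · exact (isClosed_le hb hc).inter (isClosed_le hc ha)
  · exact (isClosed_le hb ha).inter (isClosed_le ha hc)
  · exact (isClosed_le ha hb).inter (isClosed_le hb hc)

/-- A piece not containing x is absent near x, because it is closed. The remaining finitely many
pieces share the derivative f', so one little-o estimate holds on all of them. -/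
lemma hasFDerivAt_of_finite_closed_cover {E F ι : Type*} [NormedAddCommGroup E]
    [NormedSpace ℝ E] [NormedAddCommGroup F] [NormedSpace ℝ F] [Finite ι] {f : E → F}
    {g : ι → E → F} {f' : E →L[ℝ] F} {S : ι → Set E} {x : E} (hS : ∀ i, IsClosed (S i))
    (hcov : ∀ y, ∃ i, y ∈ S i) (hfg : ∀ i, ∀ᶠ y in 𝓝 x, y ∈ S i → f y = g i y)
    (hg : ∀ i, x ∈ S i → HasFDerivAt (g i) f' x) : HasFDerivAt f f' x := by
  rw [hasFDerivAt_iff_isLittleO, Asymptotics.isLittleO_iff]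
  intro ε hε
  have : ∀ i, ∀ᶠ y in 𝓝 x, y ∈ S i → ‖f y - f x - f' (y - x)‖ ≤ ε * ‖y - x‖ := by
    intro i
    by_cases hx : x ∈ S i
    · have hgi := (Asymptotics.isLittleO_iff.1 (hasFDerivAt_iff_isLittleO.1 (hg i hx))) hε
      filter_upwards [hgi, hfg i] with y hy hfy hyS
      rwa [hfy hyS, (hfg i).self_of_nhds hx]
    · filter_upwards [(hS i).isOpen_compl.mem_nhds hx] with y hy hyS
      exact (hy hyS).elim
  filter_upwards [eventually_all.2 this] with y hy
  obtain ⟨i, hi⟩ := hcov y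
  exact hy i hi

lemma hasFDerivAt_funA {p q r : ℝ} (h : Exponents p q r) (A B C : ℝ) {z : ℝ × ℝ × ℝ}
    (hz : z ∈ openOctant) :
    HasFDerivAt (funA p q r A B C) (covector (gradA p q r A B C z)) z := by
  have ha : Continuous fun z : ℝ × ℝ × ℝ => z.1 ^ p :=
    continuous_fst.rpow_const fun _ => Or.inr h.p_pos.le
  have hb : Continuous fun z : ℝ × ℝ × ℝ => z.2.1 ^ q :=
    (Continuous.rpow_const (by fun_prop) fun _ => Or.inr h.q_pos.le)
  have hc : Continuous fun z : ℝ × ℝ × ℝ => z.2.2 ^ r :=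
    (Continuous.rpow_const (by fun_prop) fun _ => Or.inr h.r_pos.le)
  refine hasFDerivAt_of_finite_closed_cover (g := fun i => (terms p q r A B C i).eval)
    (isClosed_setOf_ordering ha hb hc) (fun y => exists_ordering _ _ _) (fun i => ?_)
    fun i hi => ?_
  · filter_upwards [isOpen_openOctant.mem_nhds hz] with y hy hyi
    rw [funA_eq_valueA h A B C (openOctant_subset hy), eval_terms_of_mem_openOctant h A B C i hy hyi]
  · rw [← grad_terms h A B C i hz hi]
    exact Terms.hasFDerivAt_eval _ hz

lemma continuous_covector : Continuous covector := by
  unfold covector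
  fun_prop

lemma diffA_eq {p q r : ℝ} (h : Exponents p q r) (A B C : ℝ) {z : ℝ × ℝ × ℝ}
    (hz : z ∈ closedOctant) : diffA p q r A B C z = covector (gradA p q r A B C z) := by
  refine extendFrom_eq (closedOctant_subset_closure hz) ?_
  refine ((continuous_covector.tendsto _).comp
    ((continuousOn_gradA h A B C z hz).mono openOctant_subset).tendsto).congr' ?_
  filter_upwards [self_mem_nhdsWithin] with y hy
  exact (hasFDerivAt_funA h A B C hy).fderiv.symm

lemma isC1 {p q r : ℝ} (h : Exponents p q r) (A B C : ℝ) : IsC1 p q r A B C := by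
  have hcont : ContinuousOn (fun z => covector (gradA p q r A B C z)) closedOctant :=
    continuous_covector.comp_continuousOn (continuousOn_gradA h A B C)
  refine ⟨(continuousOn_valueA h A B C).congr fun z hz => funA_eq_valueA h A B C hz, ?_, ?_, ?_⟩
  · rw [show (1 : WithTop ℕ∞) = 0 + 1 from rfl,
      contDiffOn_succ_iff_fderiv_of_isOpen isOpen_openOctant]
    refine ⟨fun z hz => (hasFDerivAt_funA h A B C hz).differentiableAt.differentiableWithinAt,
      by simp, contDiffOn_zero.2 ?_⟩
    exact (hcont.mono openOctant_subset).congr fun z hz => (hasFDerivAt_funA h A B C hz).fderiv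
  · intro z hz
    rw [diffA_eq h A B C (openOctant_subset hz), (hasFDerivAt_funA h A B C hz).fderiv]
  · exact hcont.congr fun z hz => diffA_eq h A B C hz

/-! ### The coefficients and two positive quadratic forms -/

/-- Size conditions on the coefficients (with `B = 1`) under which `𝒜` is sufficiently convex. -/
structure Coefficients (p q r A C : ℝ) : Prop where
  eqA : A = 8 * q * C / (p - 1)
  eqC : C = 11 * q ^ 3 * r / ((r - 1) * (q - r))

namespace Coefficients
variable {p q r A C : ℝ}

lemma lower_bound (hc : Coefficients p q r A C) (h : Exponents p q r) : 11 * q ^ 2 ≤ C := by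
  have h1 := h.one_lt_r
  have h2 := h.r_lt_q
  have hq := h.q_pos
  have hpos : 0 < (r - 1) * (q - r) := mul_pos (by linarith) (by linarith)
  rw [hc.eqC, le_div_iff₀ hpos]
  have : (r - 1) * (q - r) ≤ r * q :=
    mul_le_mul (by linarith) (by linarith) (by linarith) (by linarith)
  calc 11 * q ^ 2 * ((r - 1) * (q - r)) ≤ 11 * q ^ 2 * (r * q) := by gcongr
    _ = _ := by ring

lemma mul_eq (hc : Coefficients p q r A C) (h : Exponents p q r) :
    C * (r - 1) * (q - r) = 11 * q ^ 3 * r := by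
  have h1 : r - 1 ≠ 0 := by linarith [h.one_lt_r]
  have h2 : q - r ≠ 0 := by linarith [h.r_lt_q]
  rw [hc.eqC]; field_simp

lemma pos (hc : Coefficients p q r A C) (h : Exponents p q r) : 0 < C := by
  have := hc.lower_bound h
  have := h.q_pos
  nlinarith

end Coefficients

lemma neg_le_mul_of_abs_le {k K x y : ℝ} (hk : |k| ≤ K) : -(K * (|x| * |y|)) ≤ k * (x * y) := by
  have h1 : |k * (x * y)| = |k| * (|x| * |y|) := by rw [abs_mul, abs_mul]
  have h2 : |k| * (|x| * |y|) ≤ K * (|x| * |y|) := by gcongr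
  linarith [neg_abs_le (k * (x * y))]

lemma le_sqrt_mul_sqrt {n m m' : ℝ} (hm : 0 ≤ m) (h : n ^ 2 ≤ m * m') :
    n ≤ √m * √m' := by
  rw [← Real.sqrt_mul hm]
  exact Real.le_sqrt_of_sq_le h

/-- The quadratic form dominating the Hessian where `w ^ r` is not the largest power. -/
lemma cross_terms_le {p q r A C : ℝ} (h : Exponents p q r) (hc : Coefficients p q r A C)
    (X Y Z : ℝ) :
    2 * q * (X * Y) + 2 * (C * r) * (X * Z) + 2 * q * (Y * Z)
      ≤ 7 * q * C * X ^ 2 + q * Y ^ 2 + (C * r ^ 2 / q - r) * Z ^ 2 := by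
  have hC := hc.lower_bound h
  have hq := h.q_pos
  have hr := h.one_lt_r
  have hrq := h.r_lt_q
  have hq2 := h.two_lt_q
  have hE : 2 * q + C * r ^ 2 / (5 * q) ≤ C * r ^ 2 / q - r := by
    have h1 : 11 * q ≤ C * r ^ 2 / q := by
      rw [le_div_iff₀ hq]
      have : C * 1 ≤ C * r ^ 2 := by
        have := hc.pos h
        gcongr
        nlinarith
      nlinarith
    have h2 : C * r ^ 2 / (5 * q) = (C * r ^ 2 / q) / 5 := by field_simp
    rw [h2]; linarith
  have hK : 2 * q + 5 * q * C ≤ 7 * q * C := by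
    have : 2 * q * 1 ≤ 2 * q * C := by gcongr; nlinarith
    linarith
  -- Each of the three squares absorbs one cross term. Their total cost is 2q + 5qC in X², q in Y²
  -- and 2q + Cr²/(5q) in Z², which `hK` and `hE` fit into the available diagonal.
  have s1 : 0 ≤ q / 2 * (Y - 2 * X) ^ 2 := by positivity
  have s2 : 0 ≤ q / 2 * (Y - 2 * Z) ^ 2 := by positivity
  have hCp := hc.pos h
  have s3 : 0 ≤ 5 * q * C * (X - r / (5 * q) * Z) ^ 2 := by positivity
  have s3' : 5 * q * C * (X - r / (5 * q) * Z) ^ 2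
      = 5 * q * C * X ^ 2 - 2 * (C * r) * (X * Z) + C * r ^ 2 / (5 * q) * Z ^ 2 := by
    field_simp; ring
  have t1 := mul_le_mul_of_nonneg_right hE (sq_nonneg Z)
  have t2 := mul_le_mul_of_nonneg_right hK (sq_nonneg X)
  rw [s3'] at s3
  linarith

/-- Apply `cross_terms_le` to √m₁|x|, √m₂|y|, √m₃|z|, with mᵢ the monomial governing the i-th
diagonal entry. The −2n in the bound on kyz reserves room for the desired term 2n|y||z|. -/
lemma quadratic_form_bound {p q r A C : ℝ} (h : Exponents p q r) (hc : Coefficients p q r A C)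
    {m₁ m₂ m₃ n kx ky kz kxy kxz kyz : ℝ} (h1 : 0 ≤ m₁) (h2 : 0 ≤ m₂) (h3 : 0 ≤ m₃)
    (hkx : 7 * q * C * m₁ ≤ kx) (hky : q * m₂ ≤ ky) (hkz : (C * r ^ 2 / q - r) * m₃ ≤ kz)
    (hkxy : |kxy| ≤ 2 * q * (√m₁ * √m₂)) (hkxz : |kxz| ≤ 2 * (C * r) * (√m₁ * √m₃))
    (hkyz : |kyz| ≤ 2 * q * (√m₂ * √m₃) - 2 * n) (x y z : ℝ) :
    2 * n * (|y| * |z|) ≤ kx * x ^ 2 + ky * y ^ 2 + kz * z ^ 2 + kxy * (x * y) + kxz * (x * z)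
      + kyz * (y * z) := by
  have key := cross_terms_le h hc (√m₁ * |x|) (√m₂ * |y|) (√m₃ * |z|)
  simp only [mul_pow, sq_abs, Real.sq_sqrt h1, Real.sq_sqrt h2, Real.sq_sqrt h3] at key
  have e1 := neg_le_mul_of_abs_le (x := x) (y := y) hkxy
  have e2 := neg_le_mul_of_abs_le (x := x) (y := z) hkxz
  have e3 := neg_le_mul_of_abs_le (x := y) (y := z) hkyz
  have t1 := mul_le_mul_of_nonneg_right hkx (sq_nonneg x)
  have t2 := mul_le_mul_of_nonneg_right hky (sq_nonneg y)
  have t3 := mul_le_mul_of_nonneg_right hkz (sq_nonneg z)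
  linarith

/-- The part of the Hessian in `(v, w)` where `w ^ r` is the largest power. -/
lemma quadratic_form_bound' {p q r A C : ℝ} (h : Exponents p q r)
    (hc : Coefficients p q r A C) {m c n : ℝ} (hm : 0 ≤ m) (hmc : m ≤ c)
    (hn : n ^ 2 ≤ m * c) (y z : ℝ) :
    2 * n * (|y| * |z|) ≤ q * (q - r) / (r * (q - 2)) * m * y ^ 2
      + ((q - r) / 2 * (r * (q - 2) / q - 1) * m + (C * r - (q - r) / 2) * (r - 1) * c) * z ^ 2
      + 2 * (q - r) * m * (y * z) := by
  have hq := h.q_pos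
  have hr := h.one_lt_r
  have hrq := h.r_lt_q
  have hq2 := h.two_lt_q
  have hc0 : 0 ≤ c := hm.trans hmc
  have hns := le_sqrt_mul_sqrt hm hn
  have hms : m ≤ √m * √c := le_sqrt_mul_sqrt hm (by nlinarith)
  set Y := √m * |y| with hY
  set Z := √c * |z| with hZ
  have hY2 : Y ^ 2 = m * y ^ 2 := by rw [hY, mul_pow, sq_abs, Real.sq_sqrt hm]
  have hZ2 : Z ^ 2 = c * z ^ 2 := by rw [hZ, mul_pow, sq_abs, Real.sq_sqrt hc0]
  have hYZ : (√m * √c) * (|y| * |z|) = Y * Z := by rw [hY, hZ]; ring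
  have e1 : 2 * n * (|y| * |z|) ≤ 2 * (Y * Z) := by
    rw [← hYZ, mul_assoc]; gcongr
  have e2 : -(2 * (q - r) * (Y * Z)) ≤ 2 * (q - r) * m * (y * z) := by
    have : |2 * (q - r) * m| ≤ 2 * (q - r) * (√m * √c) := by
      rw [abs_of_nonneg (mul_nonneg (by linarith) hm)]
      exact mul_le_mul_of_nonneg_left hms (by linarith)
    refine (neg_le_mul_of_abs_le this).trans' ?_
    rw [← hYZ, mul_assoc _ (√m * √c)]
  -- The factor r(q − 2)/q − 1 may be negative; m ≤ c moves that possible loss onto c.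
  have e3 : -((q - r) / 2 * c) ≤ (q - r) / 2 * (r * (q - 2) / q - 1) * m := by
    have h0 : 0 ≤ r * (q - 2) / q :=
      div_nonneg (mul_nonneg (by linarith) (by linarith)) hq.le
    have h1 : (q - r) / 2 * m ≤ (q - r) / 2 * c := mul_le_mul_of_nonneg_left hmc (by linarith)
    have h2 : 0 ≤ (q - r) / 2 * (r * (q - 2) / q) * m :=
      mul_nonneg (mul_nonneg (by linarith) h0) hm
    linarith
  have e4 := mul_le_mul_of_nonneg_right e3 (sq_nonneg z)
  have hqr : 0 < q - r := by linarith
  -- This is the discriminant condition for the form in Y, Z. The cross coefficient q − r + 1 adds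
  -- the Hessian's q − r to the 1 required by the target 2n|y||z|. The denominator (r − 1)(q − r) of
  -- C is designed for this inequality: C r (r − 1) has size q³r²/(q − r).
  have hE : (q - r + 1) ^ 2 * (r * (q - 2) / (q * (q - r))) + (q - r) / 2 * r ≤ C * r * (r - 1) := by
    have h1 : C * r * (r - 1) = 11 * q ^ 3 * r ^ 2 / (q - r) := by
      rw [eq_div_iff hqr.ne']; linear_combination r * hc.mul_eq h
    have h2 : (q - r + 1) ^ 2 * (r * (q - 2) / (q * (q - r))) ≤ q ^ 2 * r / (q - r) := by
      rw [← mul_div_assoc, div_le_div_iff₀ (by positivity) hqr]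
      have : (q - r + 1) ^ 2 * (r * (q - 2)) ≤ q ^ 2 * (r * q) := by
        gcongr <;> linarith
      nlinarith
    have h3 : (q - r) / 2 * r ≤ q ^ 2 * r / (q - r) := by
      rw [le_div_iff₀ hqr]
      have : (q - r) * (q - r) ≤ q * q := by gcongr <;> linarith
      nlinarith
    have h4 : q ^ 2 * r / (q - r) + q ^ 2 * r / (q - r) ≤ 11 * q ^ 3 * r ^ 2 / (q - r) := by
      rw [← add_div]
      gcongr
      have : q ^ 2 * r * (1 * 1) ≤ q ^ 2 * r * (q * r) := by gcongr; linarith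
      nlinarith
    linarith
  have hη : 0 < q * (q - r) / (r * (q - 2)) := by
    have : 0 < q - 2 := by linarith
    positivity
  have hsq : 0 ≤ q * (q - r) / (r * (q - 2)) *
      (Y - (q - r + 1) * (r * (q - 2) / (q * (q - r))) * Z) ^ 2 := by positivity
  have hsq' : q * (q - r) / (r * (q - 2)) *
      (Y - (q - r + 1) * (r * (q - 2) / (q * (q - r))) * Z) ^ 2 =
      q * (q - r) / (r * (q - 2)) * Y ^ 2 - 2 * (q - r + 1) * (Y * Z)
        + (q - r + 1) ^ 2 * (r * (q - 2) / (q * (q - r))) * Z ^ 2 := by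
    have : q - 2 ≠ 0 := by linarith
    have := hqr.ne'
    have : r ≠ 0 := by linarith
    field_simp; ring
  have e5 := mul_le_mul_of_nonneg_right hE (sq_nonneg Z)
  rw [hsq', hY2] at hsq
  have hZc : c * z ^ 2 = Z ^ 2 := hZ2.symm
  have e6 : ((q - r) / 2 * (r * (q - 2) / q - 1) * m + (C * r - (q - r) / 2) * (r - 1) * c) * z ^ 2
     ≥ (C * r * (r - 1) - (q - r) / 2 * r) * Z ^ 2 := by
    rw [hZ2]
    linarith
  linarith

/-! ### The Hessian bound, region by region -/

/-- All monomials, in terms of `x ^ (1 / p)`, `x ^ (1 / q)` and `x ^ (1 / r - 1 / q)` for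
`x = u ^ p, v ^ q, w ^ r`. -/
lemma monomial_relations {p q r : ℝ} (h : Exponents p q r) {u v w : ℝ} (hu : 0 < u)
    (hv : 0 < v) (hw : 0 < w) :
    ∃ aQ aD bP bD cP cQ cD : ℝ, 0 < aQ ∧ 0 < aD ∧ 0 < bP ∧ 0 < bD ∧ 0 < cP ∧ 0 < cQ ∧ 0 < cD ∧
      u ^ p = u * aQ ^ 2 * aD ∧ v ^ q = bP * v ^ 2 * bD ∧ w ^ r = cP * cQ ^ 2 * cD ∧
      w = cQ * cD ∧ v ^ (q - q / p) = v ^ 2 * bD ∧ w ^ (r - r / p) = cQ ^ 2 * cD ∧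
      w ^ (1 - r / q) = cD ∧ u ^ (p - 2 * p / q) = u * aD ∧ w ^ (r - 2 * r / q) = cP * cD ∧
      (u ^ p ≤ v ^ q → u ≤ bP ∧ aQ ≤ v ∧ aD ≤ bD) ∧
      (v ^ q ≤ u ^ p → bP ≤ u ∧ v ≤ aQ ∧ bD ≤ aD) ∧
      (u ^ p ≤ w ^ r → u ≤ cP ∧ aQ ≤ cQ ∧ aD ≤ cD) ∧
      (w ^ r ≤ u ^ p → cP ≤ u ∧ cQ ≤ aQ ∧ cD ≤ aD) ∧
      (v ^ q ≤ w ^ r → bP ≤ cP ∧ v ≤ cQ ∧ bD ≤ cD) ∧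
      (w ^ r ≤ v ^ q → cP ≤ bP ∧ cQ ≤ v ∧ cD ≤ bD) := by
  have ha := Real.rpow_pos_of_pos hu p
  have hb := Real.rpow_pos_of_pos hv q
  have hc := Real.rpow_pos_of_pos hw r
  obtain ⟨u1, u2⟩ := rpow_relations_u h hu
  obtain ⟨v1, v2⟩ := rpow_relations_v h hv
  obtain ⟨w1, w2, w3, w4⟩ := rpow_relations_w h hw
  obtain ⟨a1, -, -, a4, -, -⟩ := rpow_relations h ha
  obtain ⟨b1, -, -, b4, -, -⟩ := rpow_relations h hb
  obtain ⟨c1, -, -, c4, -, -⟩ := rpow_relations h hc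
  have hmono : ∀ {x y : ℝ}, 0 < x → x ≤ y → x ^ (1 / p) ≤ y ^ (1 / p) ∧
      x ^ (1 / q) ≤ y ^ (1 / q) ∧ x ^ (1 / r - 1 / q) ≤ y ^ (1 / r - 1 / q) := fun hx hxy =>
    ⟨Real.rpow_le_rpow hx.le hxy (one_div_pos.2 h.p_pos).le,
      Real.rpow_le_rpow hx.le hxy (one_div_pos.2 h.q_pos).le,
      Real.rpow_le_rpow hx.le hxy (by linarith [h.one_div_q_lt])⟩
  have hpos := fun {x : ℝ} (hx : 0 < x) (y : ℝ) => Real.rpow_pos_of_pos hx y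
  have aQ := (hpos ha (1 / q)).ne'
  have bQ := (hpos hb (1 / q)).ne'
  have cQ := (hpos hc (1 / q)).ne'
  refine ⟨(u ^ p) ^ (1 / q), (u ^ p) ^ (1 / r - 1 / q), (v ^ q) ^ (1 / p),
    (v ^ q) ^ (1 / r - 1 / q), (w ^ r) ^ (1 / p), (w ^ r) ^ (1 / q), (w ^ r) ^ (1 / r - 1 / q),
    hpos ha _, hpos ha _, hpos hb _, hpos hb _, hpos hc _, hpos hc _, hpos hc _,
    ?_, ?_, ?_, ?_, ?_, ?_, ?_, ?_, ?_,
    fun hi => by simpa only [u1, v1] using hmono ha hi,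
    fun hi => by simpa only [u1, v1] using hmono hb hi,
    fun hi => by simpa only [u1] using hmono ha hi,
    fun hi => by simpa only [u1] using hmono hc hi,
    fun hi => by simpa only [v1] using hmono hb hi,
    fun hi => by simpa only [v1] using hmono hc hi⟩
  · rw [u1] at a1
    rw [a4]; nth_rewrite 1 [a1]; field_simp
  · rw [v1] at b1 b4 bQ
    rw [b4]; nth_rewrite 1 [b1]; field_simp
  · rw [c4]; nth_rewrite 1 [c1]; field_simp
  · rw [c4, w1]; field_simp
  · rw [v2, b4, v1]; rw [v1] at bQ; field_simp
  · rw [w2, c4]; field_simp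
  · rw [w3, c4]
  · rw [u2, a4, u1]; field_simp
  · rw [w4, c4]; field_simp

namespace Coefficients
variable {p q r A C : ℝ}

/-- As A(p − 1) = 8qC, the u^p term with coefficient A − (1 + C)/(p − 1) contributes p(8qC − 1 − C)
to the Hessian; this must reach the 7qC needed in `quadratic_form_bound`. -/
lemma le_p_mul (hc : Coefficients p q r A C) (h : Exponents p q r) :
    7 * q * C ≤ p * (8 * q * C - 1 - C) := by
  have hC := hc.lower_bound h
  have hq2 := h.two_lt_q
  have hp := h.one_lt_p
  have h0 : 4 * 1 ≤ C := by nlinarith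
  have h1 : 2 * C ≤ q * C := mul_le_mul_of_nonneg_right hq2.le (by linarith)
  have h2 : 1 * (8 * q * C - 1 - C) ≤ p * (8 * q * C - 1 - C) :=
    mul_le_mul_of_nonneg_right hp.le (by linarith)
  linarith

lemma two_mul_q_le (hc : Coefficients p q r A C) (h : Exponents p q r) :
    2 * q ≤ C * r := by
  have hC := hc.lower_bound h
  have hq2 := h.two_lt_q
  have hr := h.one_lt_r
  have h1 : 2 * q ≤ C := by nlinarith
  have h2 : C * 1 ≤ C * r := by
    have := hc.pos h
    gcongr
  linarith

end Coefficients

/-- The form is diagonal, so n ≤ √b√c and the arithmetic–geometric mean inequality suffice; q(q − 1)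
and Cr(r − 1) are both at least 1. -/
lemma hess_region1 {p q r A C a b c n : ℝ} (h : Exponents p q r) (hc : Coefficients p q r A C)
    (ha : 0 ≤ a) (hb : 0 ≤ b) (hc0 : 0 ≤ c) (hn : n ^ 2 ≤ b * c) (x y z : ℝ) :
    2 * n * (|y| * |z|) ≤ A * a * ((p * x) ^ 2 - p * x ^ 2) + b * ((q * y) ^ 2 - q * y ^ 2)
      + C * c * ((r * z) ^ 2 - r * z ^ 2) := by
  have hp := h.one_lt_p
  have hq := h.one_lt_q
  have hr := h.one_lt_r
  have hq2 := h.two_lt_q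
  have hqr : 0 < q - r := by linarith [h.r_lt_q]
  have hA : A * (p - 1) = 8 * q * C := by
    rw [hc.eqA]; field_simp [show p - 1 ≠ 0 by linarith]
  have hCp := hc.pos h
  have e1 : A * a * ((p * x) ^ 2 - p * x ^ 2) = p * (8 * q * C) * a * x ^ 2 := by
    rw [← hA]; ring
  have e2 : 0 ≤ p * (8 * q * C) * a * x ^ 2 := by positivity
  have hns := le_sqrt_mul_sqrt hb hn
  have e3 : 2 * n * (|y| * |z|) ≤ 2 * ((√b * |y|) * (√c * |z|)) := by
    calc 2 * n * (|y| * |z|) ≤ 2 * (√b * √c) * (|y| * |z|) := by gcongr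
      _ = _ := by ring
  have e4 : 2 * ((√b * |y|) * (√c * |z|)) ≤ b * y ^ 2 + c * z ^ 2 := by
    have := two_mul_le_add_sq (√b * |y|) (√c * |z|)
    rw [mul_pow, mul_pow, sq_abs, sq_abs, Real.sq_sqrt hb, Real.sq_sqrt hc0] at this
    linarith
  have hq1 : 1 ≤ q * (q - 1) := by nlinarith
  have hr1 : 1 ≤ C * (r * (r - 1)) := by
    have hpos : 0 < q - r := hqr
    have : C * (r * (r - 1)) = 11 * q ^ 3 * r ^ 2 / (q - r) := by
      rw [eq_div_iff hqr.ne']; linear_combination r * hc.mul_eq h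
    rw [this, le_div_iff₀ hqr]
    have h2 : q * (1 * 1) ≤ q * (q ^ 2 * r ^ 2) := by
      gcongr
      · exact one_le_pow₀ hq.le
      · exact one_le_pow₀ hr.le
    nlinarith
  have e5 : b * y ^ 2 ≤ b * ((q * y) ^ 2 - q * y ^ 2) := by
    have := mul_le_mul_of_nonneg_right hq1 (mul_nonneg hb (sq_nonneg y))
    linarith
  have e6 : c * z ^ 2 ≤ C * c * ((r * z) ^ 2 - r * z ^ 2) := by
    have := mul_le_mul_of_nonneg_right hr1 (mul_nonneg hc0 (sq_nonneg z))
    linarith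
  linarith

lemma hess_region2 {p q r A C a b m n : ℝ} (h : Exponents p q r) (hc : Coefficients p q r A C)
    (ha : 0 ≤ a) (hb : 0 ≤ b) (hm : 0 ≤ m) (hma : m ≤ a) (hn : n ^ 2 ≤ b * m) (x y z : ℝ) :
    2 * n * (|y| * |z|) ≤ (A * (p - 1) - C) / (p - 1) * a * ((p * x) ^ 2 - p * x ^ 2)
      + b * ((q * y) ^ 2 - q * y ^ 2)
      + C * p / (p - 1) * m * ((x + (r - r / p) * z) ^ 2 - (x ^ 2 + (r - r / p) * z ^ 2)) := by
  have hp := h.p_pos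
  have hq := h.q_pos
  have hr := h.r_pos
  have hq2 := h.two_lt_q
  have hC := hc.pos h
  have hns := le_sqrt_mul_sqrt hb hn
  have hms : m ≤ √a * √m := le_sqrt_mul_sqrt ha (by nlinarith)
  -- The mixed monomial m is linear in u and has no x² term. By the exponent relation its z²
  -- coefficient is Cr²/q and its xz coefficient 2Cr; since m ≤ a, the latter is controlled by √a√m.
  refine (quadratic_form_bound h hc (m₁ := a) (m₂ := b) (m₃ := m) (kx := p * (8 * q * C - C) * a)
    (ky := q * (q - 1) * b) (kz := C * r ^ 2 / q * m) (kxy := 0) (kxz := 2 * (C * r) * m)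
    (kyz := 0) ha hb hm ?_ ?_ ?_ ?_ ?_ ?_ x y z).trans_eq ?_
  · refine mul_le_mul_of_nonneg_right ((hc.le_p_mul h).trans ?_) ha
    gcongr; linarith
  · refine mul_le_mul_of_nonneg_right ?_ hb
    nlinarith
  · exact mul_le_mul_of_nonneg_right (by linarith) hm
  · rw [abs_zero]; positivity
  · rw [abs_of_nonneg (by positivity)]
    gcongr
  · rw [abs_zero]
    nlinarith [mul_nonneg (Real.sqrt_nonneg b) (Real.sqrt_nonneg m)]
  · have hd := h.denom_pos
    have hpe := h.p_eq
    have hpe1 := h.p_sub_one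
    obtain ⟨d, hde⟩ : ∃ d, d = q * r - q - r := ⟨_, rfl⟩
    rw [← hde] at hd hpe hpe1
    rw [hc.eqA, hpe1]
    clear h hc hpe1
    subst hpe
    field_simp
    rw [hde]; ring

lemma hess_region3 {p q r A C a m₂ m₃ n : ℝ} (h : Exponents p q r)
    (hc : Coefficients p q r A C) (ha : 0 ≤ a) (hm₂ : 0 ≤ m₂) (hm₃ : 0 ≤ m₃) (hma₂ : m₂ ≤ a)
    (hma₃ : m₃ ≤ a) (hn : n ^ 2 ≤ m₂ * m₃) (x y z : ℝ) :
    2 * n * (|y| * |z|) ≤ (A * (p - 1) - (1 + C)) / (p - 1) * a * ((p * x) ^ 2 - p * x ^ 2)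
      + p / (p - 1) * m₂ * ((x + (q - q / p) * y) ^ 2 - (x ^ 2 + (q - q / p) * y ^ 2))
      + C * p / (p - 1) * m₃ * ((x + (r - r / p) * z) ^ 2 - (x ^ 2 + (r - r / p) * z ^ 2)) := by
  have hp := h.p_pos
  have hq := h.q_pos
  have hr := h.r_pos
  have hq2 := h.two_lt_q
  have hrq := h.r_lt_q
  have hC := hc.pos h
  have hns := le_sqrt_mul_sqrt hm₂ hn
  have hms₂ : m₂ ≤ √a * √m₂ := le_sqrt_mul_sqrt ha (by nlinarith)
  have hms₃ : m₃ ≤ √a * √m₃ := le_sqrt_mul_sqrt ha (by nlinarith)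
  refine (quadratic_form_bound h hc (m₁ := a) (m₂ := m₂) (m₃ := m₃)
    (kx := p * (8 * q * C - 1 - C) * a)
    (ky := q ^ 2 / r * m₂) (kz := C * r ^ 2 / q * m₃) (kxy := 2 * q * m₂)
    (kxz := 2 * (C * r) * m₃) (kyz := 0) ha hm₂ hm₃ ?_ ?_ ?_ ?_ ?_ ?_ x y z).trans_eq ?_
  · exact mul_le_mul_of_nonneg_right (hc.le_p_mul h) ha
  · refine mul_le_mul_of_nonneg_right ?_ hm₂
    rw [le_div_iff₀ hr]
    nlinarith
  · exact mul_le_mul_of_nonneg_right (by linarith) hm₃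
  · rw [abs_of_nonneg (by positivity)]
    gcongr
  · rw [abs_of_nonneg (by positivity)]
    gcongr
  · rw [abs_zero]
    nlinarith [mul_nonneg (Real.sqrt_nonneg m₂) (Real.sqrt_nonneg m₃)]
  · have hd := h.denom_pos
    have hpe := h.p_eq
    have hpe1 := h.p_sub_one
    obtain ⟨d, hde⟩ : ∃ d, d = q * r - q - r := ⟨_, rfl⟩
    rw [← hde] at hd hpe hpe1
    rw [hc.eqA, hpe1]
    clear h hc hpe1
    subst hpe
    field_simp
    rw [hde]; ring

/-- The monomial with v²w^(1 − r/q) is concave in w, and its yz coefficient 2(q − r)m₂ does not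
vanish. The latter still leaves 2r√m₂√m₃ ≥ 2n out of the 2q√m₂√m₃ allowed, because r > 1. -/
lemma hess_region4 {p q r A C a m₂ m₃ n : ℝ} (h : Exponents p q r)
    (hc : Coefficients p q r A C) (ha : 0 ≤ a) (hm₂ : 0 ≤ m₂) (hm₂₃ : m₂ ≤ m₃)
    (hma₃ : m₃ ≤ a) (hn : n ^ 2 ≤ m₂ * m₃) (x y z : ℝ) :
    2 * n * (|y| * |z|) ≤ (A * (p - 1) - (1 + C)) / (p - 1) * a * ((p * x) ^ 2 - p * x ^ 2)
      + q / 2 * m₂ * ((x + 2 * y + (1 - r / q) * z) ^ 2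
        - (x ^ 2 + 2 * y ^ 2 + (1 - r / q) * z ^ 2))
      + (2 * C * p * r - p * (q - r)) / (2 * r * (p - 1)) * m₃
        * ((x + (r - r / p) * z) ^ 2 - (x ^ 2 + (r - r / p) * z ^ 2)) := by
  have hp := h.p_pos
  have hq := h.q_pos
  have hr := h.r_pos
  have hr1 := h.one_lt_r
  have hq2 := h.two_lt_q
  have hrq := h.r_lt_q
  have hC := hc.pos h
  have hCr := hc.two_mul_q_le h
  have hm₃ : 0 ≤ m₃ := hm₂.trans hm₂₃
  have hns := le_sqrt_mul_sqrt hm₂ hn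
  have hms₂ : m₂ ≤ √a * √m₂ := le_sqrt_mul_sqrt ha (by nlinarith)
  have hms₃ : m₃ ≤ √a * √m₃ := le_sqrt_mul_sqrt ha (by nlinarith)
  have hms : m₂ ≤ √m₂ * √m₃ := le_sqrt_mul_sqrt hm₂ (by nlinarith)
  refine (quadratic_form_bound h hc (m₁ := a) (m₂ := m₂) (m₃ := m₃)
    (kx := p * (8 * q * C - 1 - C) * a) (ky := q * m₂)
    (kz := (C * r ^ 2 / q - (q - r) * r / (2 * q)) * m₃ - (q - r) * r / (2 * q) * m₂)
    (kxy := 2 * q * m₂) (kxz := (q - r) * m₂ + (2 * (C * r) - (q - r)) * m₃)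
    (kyz := 2 * (q - r) * m₂) ha hm₂ hm₃ ?_ le_rfl ?_ ?_ ?_ ?_ x y z).trans_eq ?_
  · exact mul_le_mul_of_nonneg_right (hc.le_p_mul h) ha
  -- There are two losses in z², from the concavity of the m₂ monomial and from the reduced
  -- coefficient of the m₃ monomial. As m₂ ≤ m₃ they total at most r m₃, which explains the −r in
  -- `quadratic_form_bound`.
  · have h1 : 2 * ((q - r) * r / (2 * q)) ≤ r := by
      rw [← mul_div_assoc, div_le_iff₀ (by positivity)]
      nlinarith
    have h2 : 0 ≤ (q - r) * r / (2 * q) :=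
      div_nonneg (mul_nonneg (by linarith) hr.le) (by linarith)
    have h3 := mul_le_mul_of_nonneg_left hm₂₃ h2
    have h4 := mul_le_mul_of_nonneg_right h1 hm₃
    linarith
  · rw [abs_of_nonneg (by positivity)]
    gcongr
  · have h1 : (q - r) * m₂ ≤ (q - r) * m₃ := mul_le_mul_of_nonneg_left hm₂₃ (by linarith)
    have h2 : 0 ≤ (q - r) * m₂ := mul_nonneg (by linarith) hm₂
    have h3 : 0 ≤ (2 * (C * r) - (q - r)) * m₃ := mul_nonneg (by linarith) hm₃
    rw [abs_of_nonneg (by linarith)]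
    calc _ ≤ 2 * (C * r) * m₃ := by linarith
      _ ≤ _ := by gcongr
  · rw [abs_of_nonneg (mul_nonneg (by linarith) hm₂)]
    have h1 : 2 * (q - r) * m₂ ≤ 2 * (q - r) * (√m₂ * √m₃) :=
      mul_le_mul_of_nonneg_left hms (by linarith)
    have h2 : 1 * (√m₂ * √m₃) ≤ r * (√m₂ * √m₃) := by gcongr
    linarith
  · have hd := h.denom_pos
    have hpe := h.p_eq
    have hpe1 := h.p_sub_one
    obtain ⟨d, hde⟩ : ∃ d, d = q * r - q - r := ⟨_, rfl⟩
    rw [← hde] at hd hpe hpe1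
    rw [hc.eqA, hpe1]
    clear h hc hpe1
    subst hpe
    field_simp
    rw [hde]; ring

/-- The sum of the terms common to the two regions where `w ^ r` is the largest power. -/
lemma hess_region56 {p q r A C m c n : ℝ} (h : Exponents p q r)
    (hc : Coefficients p q r A C) (hm : 0 ≤ m) (hmc : m ≤ c) (hn : n ^ 2 ≤ m * c) (y z : ℝ) :
    2 * n * (|y| * |z|) ≤ q * (q - r) / (2 * r * (q - 2)) * m
        * ((2 * y + (r - 2 * r / q) * z) ^ 2 - (2 * y ^ 2 + (r - 2 * r / q) * z ^ 2))
      + (2 * C * r - (q - r)) / (2 * r) * c * ((r * z) ^ 2 - r * z ^ 2) := by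
  refine (quadratic_form_bound' h hc hm hmc hn y z).trans_eq ?_
  have hq := h.q_pos
  have hr := h.r_pos
  have hq2 : q - 2 ≠ 0 := by linarith [h.two_lt_q]
  field_simp
  ring

/-- Completing the square in y leaves a deficit (q + p(q − 2))/2 · m₂x², which the u^p term covers
because m₂ ≤ a and A is large. -/
lemma hess_region5 {p q r A C a m₂ : ℝ} (h : Exponents p q r)
    (hc : Coefficients p q r A C) (hm₂ : 0 ≤ m₂) (hma₂ : m₂ ≤ a) (x y : ℝ) :
    0 ≤ (2 * A * r * (p - 1) - (q + r)) / (2 * r * (p - 1)) * a * ((p * x) ^ 2 - p * x ^ 2)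
      + q ^ 2 / (2 * p * (q - 2)) * m₂ * (((p - 2 * p / q) * x + 2 * y) ^ 2
        - ((p - 2 * p / q) * x ^ 2 + 2 * y ^ 2)) := by
  have hp := h.p_pos
  have hq := h.q_pos
  have hr := h.r_pos
  have hr1 := h.one_lt_r
  have hq2 := h.two_lt_q
  have hrq := h.r_lt_q
  have hC := hc.lower_bound h
  have hq2' : 0 < q - 2 := by linarith
  have hp1 := h.one_lt_p
  have hK : (q + p * (q - 2)) / 2 ≤ p * (8 * q * C - (q + r) / (2 * r)) := by
    have h1 : (q + r) / (2 * r) ≤ q := by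
      rw [div_le_iff₀ (by positivity)]
      nlinarith
    have h2 : 2 * q ≤ 8 * q * C - (q + r) / (2 * r) := by
      have : 1 ≤ C := by nlinarith
      have : q * 1 ≤ q * C := by gcongr
      linarith
    have h3 : p * (2 * q) ≤ p * (8 * q * C - (q + r) / (2 * r)) := by gcongr
    have h4 : 1 * q ≤ p * q := by gcongr
    linarith
  have ha : 0 ≤ a := hm₂.trans hma₂
  have h1 : (q + p * (q - 2)) / 2 * m₂ ≤ p * (8 * q * C - (q + r) / (2 * r)) * a := by
    have : 0 ≤ (q + p * (q - 2)) / 2 := by positivity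
    have := this.trans hK
    gcongr
  have h2 := mul_le_mul_of_nonneg_right h1 (sq_nonneg x)
  have h3 : 0 ≤ q ^ 2 / (p * (q - 2)) * m₂ * (y + (p - 2 * p / q) * x) ^ 2 := by positivity
  have h4 : (2 * A * r * (p - 1) - (q + r)) / (2 * r * (p - 1)) * a * ((p * x) ^ 2 - p * x ^ 2)
      = p * (8 * q * C - (q + r) / (2 * r)) * a * x ^ 2 := by
    have : p - 1 ≠ 0 := by linarith
    rw [hc.eqA]
    field_simp
  have h5 : q ^ 2 / (2 * p * (q - 2)) * m₂ * (((p - 2 * p / q) * x + 2 * y) ^ 2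
        - ((p - 2 * p / q) * x ^ 2 + 2 * y ^ 2)) =
      q ^ 2 / (p * (q - 2)) * m₂ * (y + (p - 2 * p / q) * x) ^ 2
        - (q + p * (q - 2)) / 2 * m₂ * x ^ 2 := by
    field_simp
    ring
  rw [h4, h5]
  linarith

lemma hess_region6 {p q r A C a b : ℝ} (h : Exponents p q r)
    (hc : Coefficients p q r A C) (ha : 0 ≤ a) (hb : 0 ≤ b) (x y : ℝ) :
    0 ≤ A * a * ((p * x) ^ 2 - p * x ^ 2)
      + q / (p * (q - 2)) * b * ((q * y) ^ 2 - q * y ^ 2) := by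
  have hp := h.p_pos
  have hq := h.q_pos
  have hq2 : 0 < q - 2 := by linarith [h.two_lt_q]
  have hq1 : 0 < q - 1 := by linarith
  have hp1 : 0 < p - 1 := by linarith [h.one_lt_p]
  have hC := hc.pos h
  have h1 : A * a * ((p * x) ^ 2 - p * x ^ 2) = A * a * p * (p - 1) * x ^ 2 := by ring
  have h2 : q / (p * (q - 2)) * b * ((q * y) ^ 2 - q * y ^ 2)
      = q / (p * (q - 2)) * b * q * (q - 1) * y ^ 2 := by ring
  rw [h1, h2, hc.eqA]
  positivity

/-- With (x, y, z) = (h_u/u, h_v/v, h_w/w) this reads d²𝒜(h,h) ≥ 2u|h_v||h_w|. In each region the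
ordering of the powers gives (uvw)² ≤ (v-diagonal monomial) · (w-diagonal monomial), along with the
comparisons of monomials required by the regional lemma. -/
lemma hess_weighted_le {p q r A C : ℝ} (h : Exponents p q r) (hc : Coefficients p q r A C)
    (i : Fin 6) {u v w : ℝ} (hu : 0 < u) (hv : 0 < v) (hw : 0 < w)
    (hi : Ordering (u ^ p) (v ^ q) (w ^ r) i) (x y z : ℝ) :
    2 * (u * v * w) * (|y| * |z|) ≤
      (terms p q r A 1 C i).weighted (logHess (x, y, z)) (u, v, w) := by
  obtain ⟨aQ, aD, bP, bD, cP, cQ, cD, haQ, haD, hbP, hbD, hcP, hcQ, hcD, e1, e2, e3, e4, e5, e6,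
    e7, e8, e9, i1, i2, i3, i4, i5, i6⟩ := monomial_relations h hu hv hw
  fin_cases i <;> obtain ⟨h1, h2⟩ := hi
  · refine (hess_region1 h hc (a := u ^ p) (b := v ^ q) (c := w ^ r) (by positivity)
      (by positivity) (by positivity) ?_ x y z).trans_eq ?_
    · rw [e2, e3, e4]
      obtain ⟨k1, -, -⟩ := i1 (h1.trans h2)
      obtain ⟨k2, -, -⟩ := i3 h1
      obtain ⟨-, -, k3⟩ := i6 h2
      calc (u * v * (cQ * cD)) ^ 2 = (u * v ^ 2 * cD) * (u * cQ ^ 2 * cD) := by ring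
        _ ≤ (bP * v ^ 2 * bD) * (cP * cQ ^ 2 * cD) := by gcongr
    · simp only [terms, Terms.weighted_cons, Terms.weighted_nil, logHess, Real.rpow_zero]
      ring
  · obtain ⟨-, k1, k2⟩ := i4 h1
    obtain ⟨k3, k4, -⟩ := i1 h2
    obtain ⟨-, -, k5⟩ := i6 (h1.trans h2)
    refine (hess_region2 h hc (a := u ^ p) (b := v ^ q) (m := u * w ^ (r - r / p))
      (by positivity) (by positivity) (by positivity) ?_ ?_ x y z).trans_eq ?_
    · rw [e1, e6, mul_assoc]
      gcongr
    · rw [e2, e6, e4]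
      calc (u * v * (cQ * cD)) ^ 2 = (u * v ^ 2 * cD) * (u * (cQ ^ 2 * cD)) := by ring
        _ ≤ (bP * v ^ 2 * bD) * (u * (cQ ^ 2 * cD)) := by gcongr
    · simp only [terms, Terms.weighted_cons, Terms.weighted_nil, logHess, Real.rpow_zero,
        Real.rpow_one]
      ring
  · obtain ⟨-, k1, k2⟩ := i6 h1
    obtain ⟨-, k3, k4⟩ := i2 h2
    obtain ⟨-, k5, k6⟩ := i4 (h1.trans h2)
    refine (hess_region3 h hc (a := u ^ p) (m₂ := u * v ^ (q - q / p))
      (m₃ := u * w ^ (r - r / p)) (by positivity) (by positivity) (by positivity)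
      ?_ ?_ ?_ x y z).trans_eq ?_
    · rw [e1, e5, mul_assoc]
      gcongr
    · rw [e1, e6, mul_assoc]
      gcongr
    · rw [e5, e6, e4]
      calc (u * v * (cQ * cD)) ^ 2 = (u * (v ^ 2 * cD)) * (u * (cQ ^ 2 * cD)) := by ring
        _ ≤ (u * (v ^ 2 * bD)) * (u * (cQ ^ 2 * cD)) := by gcongr
    · simp only [terms, Terms.weighted_cons, Terms.weighted_nil, logHess, Real.rpow_zero,
        Real.rpow_one]
      ring
  · obtain ⟨-, k1, k2⟩ := i5 h1
    obtain ⟨-, k3, k4⟩ := i4 h2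
    refine (hess_region4 h hc (a := u ^ p) (m₂ := u * v ^ 2 * w ^ (1 - r / q))
      (m₃ := u * w ^ (r - r / p)) (by positivity) (by positivity)
      ?_ ?_ ?_ x y z).trans_eq ?_
    · rw [e7, e6, mul_assoc]
      gcongr
    · rw [e1, e6, mul_assoc]
      gcongr
    -- Here the product of the two monomials is exactly (uvw)².
    · rw [e7, e6, e4]
      exact le_of_eq (by ring)
    · simp only [terms, Terms.weighted_cons, Terms.weighted_nil, logHess, Real.rpow_zero,
        Real.rpow_one, Real.rpow_two]
      ring
  · obtain ⟨-, k1, k2⟩ := i2 h1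
    obtain ⟨k3, k4, k5⟩ := i3 h2
    obtain ⟨-, k6, -⟩ := i5 (h1.trans h2)
    -- When w^r is the largest power the form splits into an (x, y) part, only shown to be
    -- nonnegative, and a (y, z) part, which alone yields the lower bound.
    have s1 := hess_region5 h hc (a := u ^ p) (m₂ := u ^ (p - 2 * p / q) * v ^ 2)
      (by positivity) (by
        rw [e8, e1]
        calc u * aD * v ^ 2 = u * v ^ 2 * aD := by ring
          _ ≤ u * aQ ^ 2 * aD := by gcongr) x y
    have s2 := hess_region56 h hc (m := v ^ 2 * w ^ (r - 2 * r / q)) (c := w ^ r)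
      (n := u * v * w) (by positivity) (by
        rw [e9, e3]
        calc v ^ 2 * (cP * cD) = cP * v ^ 2 * cD := by ring
          _ ≤ cP * cQ ^ 2 * cD := by gcongr) (by
        rw [e9, e3, e4]
        calc (u * v * (cQ * cD)) ^ 2 = (v ^ 2 * (u * cD)) * (u * cQ ^ 2 * cD) := by ring
          _ ≤ (v ^ 2 * (cP * cD)) * (cP * cQ ^ 2 * cD) := by gcongr) y z
    refine (le_add_of_nonneg_of_le s1 s2).trans_eq ?_
    simp only [terms, Terms.weighted_cons, Terms.weighted_nil, logHess, Real.rpow_zero,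
      Real.rpow_two]
    ring
  · obtain ⟨k3, k4, k5⟩ := i3 (h1.trans h2)
    obtain ⟨-, k6, -⟩ := i5 h2
    have s1 := hess_region6 h hc (a := u ^ p) (b := v ^ q)
      (by positivity) (by positivity) x y
    have s2 := hess_region56 h hc (m := v ^ 2 * w ^ (r - 2 * r / q)) (c := w ^ r)
      (n := u * v * w) (by positivity) (by
        rw [e9, e3]
        calc v ^ 2 * (cP * cD) = cP * v ^ 2 * cD := by ring
          _ ≤ cP * cQ ^ 2 * cD := by gcongr) (by
        rw [e9, e3, e4]
        calc (u * v * (cQ * cD)) ^ 2 = (v ^ 2 * (u * cD)) * (u * cQ ^ 2 * cD) := by ring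
          _ ≤ (v ^ 2 * (cP * cD)) * (cP * cQ ^ 2 * cD) := by gcongr) y z
    refine (le_add_of_nonneg_of_le s1 s2).trans_eq ?_
    simp only [terms, Terms.weighted_cons, Terms.weighted_nil, logHess, Real.rpow_zero,
      Real.rpow_two]
    ring

/-! ### Integrating the Hessian bound along segments -/

lemma add_smul_sub_mem_openOctant {z z₁ : ℝ × ℝ × ℝ} (hz : z ∈ openOctant)
    (hz₁ : z₁ ∈ openOctant) {t : ℝ} (ht : t ∈ Icc (0 : ℝ) 1) :
    z + t • (z₁ - z) ∈ openOctant := by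
  have key : ∀ {a b : ℝ}, 0 < a → 0 < b → 0 < a + t * (b - a) := by
    intro a b ha hb
    obtain ⟨h0, h1⟩ := ht
    have e : a + t * (b - a) = (1 - t) * a + t * b := by ring
    rw [e]
    rcases h0.eq_or_lt with rfl | h0
    · simpa using ha
    · have := mul_pos h0 hb
      have := mul_nonneg (sub_nonneg.2 h1) ha.le
      linarith
  exact ⟨key hz.1 hz₁.1, key hz.2.1 hz₁.2.1, key hz.2.2 hz₁.2.2⟩

/-- Growth of the directional derivative of `𝒜` along a segment. -/
lemma directional_derivative_growth {p q r A C : ℝ} (h : Exponents p q r)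
    (hc : Coefficients p q r A C) {z z₁ : ℝ × ℝ × ℝ} (hz : z ∈ openOctant)
    (hz₁ : z₁ ∈ openOctant) {t : ℝ} (ht : t ∈ Icc (0 : ℝ) 1) :
    covector (gradA p q r A 1 C z) (z₁ - z)
        + |z₁.2.1 - z.2.1| * |z₁.2.2 - z.2.2| * (2 * z.1 * t + (z₁.1 - z.1) * t ^ 2)
      ≤ covector (gradA p q r A 1 C (z + t • (z₁ - z))) (z₁ - z) := by
  have hl : Continuous fun t : ℝ => z + t • (z₁ - z) := by fun_prop
  have hseg := fun t (ht : t ∈ Icc (0 : ℝ) 1) => add_smul_sub_mem_openOctant hz hz₁ ht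
  have key := sub_le_sub_of_piecewise_deriv (x := 0) (y := 1)
    (f := fun t => covector (gradA p q r A 1 C (z + t • (z₁ - z))) (z₁ - z))
    -- This is the antiderivative, vanishing at 0, of 2|Δv||Δw| times the first coordinate at time
    -- t.
    (b := fun t => |z₁.2.1 - z.2.1| * |z₁.2.2 - z.2.2| *
      (2 * z.1 * t + (z₁.1 - z.1) * t ^ 2))
    (b' := fun t => |z₁.2.1 - z.2.1| * |z₁.2.2 - z.2.2| * (2 * z.1 + (z₁.1 - z.1) * (2 * t)))
    ?_ ?_
    (fun i => {t : ℝ | Ordering ((z + t • (z₁ - z)).1 ^ p) ((z + t • (z₁ - z)).2.1 ^ q)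
      ((z + t • (z₁ - z)).2.2 ^ r) i})
    (isClosed_setOf_ordering (hl.fst.rpow_const fun _ => Or.inr h.p_pos.le)
      (hl.snd.fst.rpow_const fun _ => Or.inr h.q_pos.le)
      (hl.snd.snd.rpow_const fun _ => Or.inr h.r_pos.le))
    (fun t _ => exists_ordering _ _ _)
    (fun i t => covector ((terms p q r A 1 C i).grad (z + t • (z₁ - z))) (z₁ - z))
    (fun i t => (terms p q r A 1 C i).weighted (logHess
      ((z₁ - z).1 / (z + t • (z₁ - z)).1, (z₁ - z).2.1 / (z + t • (z₁ - z)).2.1,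
        (z₁ - z).2.2 / (z + t • (z₁ - z)).2.2)) (z + t • (z₁ - z)))
    (fun i t ht => Terms.hasDerivAt_grad _ z (z₁ - z) t (hseg t ht))
    (fun i t ht hi => by simp only [grad_terms h A 1 C i (hseg t ht) hi]) ?_ t ht
  · simp only [zero_smul, add_zero] at key
    linarith
  · have h1 : ContinuousOn (fun t : ℝ => gradA p q r A 1 C (z + t • (z₁ - z))) (Icc 0 1) :=
      (continuousOn_gradA h A 1 C).comp hl.continuousOn
        fun t ht => openOctant_subset (hseg t ht)
    exact (continuous_covector.comp_continuousOn h1).clm_apply continuousOn_const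
  · intro t
    have h1 := ((hasDerivAt_id t).const_mul (2 * z.1)).add
      (((hasDerivAt_id t).pow 2).const_mul (z₁.1 - z.1))
    refine (h1.const_mul (|z₁.2.1 - z.2.1| * |z₁.2.2 - z.2.2|)).congr_deriv ?_
    simp
  · intro i t ht hi
    obtain ⟨hu, hv, hw⟩ := hseg t ht
    refine (hess_weighted_le h hc i hu hv hw hi _ _ _).trans' (le_of_eq ?_)
    rw [abs_div, abs_div, abs_of_pos hv, abs_of_pos hw]
    have e : (z + t • (z₁ - z)).1 = z.1 + t * (z₁.1 - z.1) := rfl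
    have e2 : (z₁ - z).2.1 = z₁.2.1 - z.2.1 := rfl
    have e3 : (z₁ - z).2.2 = z₁.2.2 - z.2.2 := rfl
    rw [e2, e3]
    field_simp
    rw [e]; ring

/-- Second integration: 2ut + (u₁ − u)t² integrates over [0, 1] to u + (u₁ − u)/3 = 2u/3 + u₁/3. -/
lemma taylor_openOctant {p q r A C : ℝ} (h : Exponents p q r)
    (hc : Coefficients p q r A C) {z z₁ : ℝ × ℝ × ℝ} (hz : z ∈ openOctant)
    (hz₁ : z₁ ∈ openOctant) :
    valueA p q r A 1 C z + covector (gradA p q r A 1 C z) (z₁ - z)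
        + |z₁.2.1 - z.2.1| * |z₁.2.2 - z.2.2| * (z.1 + (z₁.1 - z.1) / 3)
      ≤ valueA p q r A 1 C z₁ := by
  rw [← funA_eq_valueA h A 1 C (openOctant_subset hz),
    ← funA_eq_valueA h A 1 C (openOctant_subset hz₁)]
  have hseg := fun t (ht : t ∈ Icc (0 : ℝ) 1) => add_smul_sub_mem_openOctant hz hz₁ ht
  have hl : ∀ t : ℝ, HasDerivAt (fun t : ℝ => z + t • (z₁ - z)) (z₁ - z) t := fun t => by
    simpa using ((hasDerivAt_id t).smul_const (z₁ - z)).const_add z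
  have hφ : ∀ t ∈ Icc (0 : ℝ) 1, HasDerivAt (fun t : ℝ => funA p q r A 1 C (z + t • (z₁ - z)))
      (covector (gradA p q r A 1 C (z + t • (z₁ - z))) (z₁ - z)) t := fun t ht => by
    have := hasFDerivAt_funA h A 1 C (hseg t ht)
    exact this.comp_hasDerivAt t (hl t)
  have key := sub_le_sub_of_piecewise_deriv (ι := Unit) (x := 0) (y := 1)
    (f := fun t : ℝ => funA p q r A 1 C (z + t • (z₁ - z)))
    (b := fun t => covector (gradA p q r A 1 C z) (z₁ - z) * t
      + |z₁.2.1 - z.2.1| * |z₁.2.2 - z.2.2| * (z.1 * t ^ 2 + (z₁.1 - z.1) / 3 * t ^ 3))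
    (b' := fun t => covector (gradA p q r A 1 C z) (z₁ - z)
      + |z₁.2.1 - z.2.1| * |z₁.2.2 - z.2.2| * (2 * z.1 * t + (z₁.1 - z.1) * t ^ 2))
    (fun t ht => (hφ t ht).continuousAt.continuousWithinAt) ?_ (fun _ => univ)
    (fun _ => isClosed_univ) (fun t _ => ⟨(), trivial⟩) _ _ (fun _ => hφ) (fun _ _ _ _ => rfl)
    (fun _ t ht _ => directional_derivative_growth h hc hz hz₁ ht) 1 (right_mem_Icc.2 zero_le_one)
  · simp only [zero_smul, add_zero, one_smul, add_sub_cancel] at key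
    linarith
  · intro t
    have h1 := (((hasDerivAt_id t).pow 2).const_mul z.1).add
      (((hasDerivAt_id t).pow 3).const_mul ((z₁.1 - z.1) / 3))
    refine (((hasDerivAt_id t).const_mul _).add
      (h1.const_mul (|z₁.2.1 - z.2.1| * |z₁.2.2 - z.2.2|))).congr_deriv ?_
    simp only [id, Nat.cast_ofNat, Nat.reduceSub, pow_one, mul_one]
    ring

/-- The quantitative convexity of `𝒜`, up to the boundary. -/
lemma taylor {p q r A C : ℝ} (h : Exponents p q r)
    (hc : Coefficients p q r A C) {z z₁ : ℝ × ℝ × ℝ} (hz : z ∈ closedOctant)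
    (hz₁ : z₁ ∈ closedOctant) :
    valueA p q r A 1 C z + covector (gradA p q r A 1 C z) (z₁ - z)
        + |z₁.2.1 - z.2.1| * |z₁.2.2 - z.2.2| * (z.1 + (z₁.1 - z.1) / 3)
      ≤ valueA p q r A 1 C z₁ := by
  have t1 := tendsto_add_smul_one_openOctant hz
  have t2 := tendsto_add_smul_one_openOctant hz₁
  have c1 := fun {z} (hz : z ∈ closedOctant) => ((continuousOn_valueA h A 1 C z hz).mono
    openOctant_subset).tendsto
  have c2 := ((((continuous_covector.comp_continuousOn (continuousOn_gradA h A 1 C)).clm_apply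
    (continuousOn_const (c := z₁ - z))) z hz).mono openOctant_subset).tendsto
  have key := ((((c1 hz).comp t1).add (c2.comp t1)).add_const
    (|z₁.2.1 - z.2.1| * |z₁.2.2 - z.2.2| * (z.1 + (z₁.1 - z.1) / 3)))
  refine le_of_tendsto_of_tendsto key ((c1 hz₁).comp t2) ?_
  filter_upwards [self_mem_nhdsWithin] with ε hε
  have := taylor_openOctant h hc (add_smul_one_mem_openOctant hz hε)
    (add_smul_one_mem_openOctant hz₁ hε)
  have d1 : (z₁ + ε • ((1 : ℝ), (1 : ℝ), (1 : ℝ))).1 - (z + ε • ((1 : ℝ), (1 : ℝ), (1 : ℝ))).1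
      = z₁.1 - z.1 := add_sub_add_right_eq_sub _ _ _
  have d2 : (z₁ + ε • ((1 : ℝ), (1 : ℝ), (1 : ℝ))).2.1
      - (z + ε • ((1 : ℝ), (1 : ℝ), (1 : ℝ))).2.1 = z₁.2.1 - z.2.1 :=
    add_sub_add_right_eq_sub _ _ _
  have d3 : (z₁ + ε • ((1 : ℝ), (1 : ℝ), (1 : ℝ))).2.2
      - (z + ε • ((1 : ℝ), (1 : ℝ), (1 : ℝ))).2.2 = z₁.2.2 - z.2.2 :=
    add_sub_add_right_eq_sub _ _ _
  -- A common shift leaves all differences unchanged and only increases u, so the remainder of the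
  -- shifted inequality dominates the fixed one.
  have d4 : z.1 ≤ (z + ε • ((1 : ℝ), (1 : ℝ), (1 : ℝ))).1 :=
    le_add_of_nonneg_right (mul_nonneg (le_of_lt hε) zero_le_one)
  rw [d1, d2, d3, add_sub_add_right_eq_sub] at this
  refine this.trans' (add_le_add le_rfl (mul_le_mul_of_nonneg_left ?_ (by positivity)))
  linarith

/-! ### The range of ℬ -/

lemma gradA_zero {p q r : ℝ} (h : Exponents p q r) (A B C : ℝ) : gradA p q r A B C 0 = 0 := by
  have h1 : 1 - p⁻¹ ≠ 0 := by simpa only [one_div] using h.one_sub_one_div_p_pos.ne'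
  simp [gradA, gradU, gradV, gradW, Real.zero_rpow, h.p_pos.ne', h.q_pos.ne', h.r_pos.ne', h1]

lemma valueA_nonneg {p q r A C : ℝ} (h : Exponents p q r) (hc : Coefficients p q r A C)
    {z : ℝ × ℝ × ℝ} (hz : z ∈ closedOctant) : 0 ≤ valueA p q r A 1 C z := by
  have h0 : (0 : ℝ × ℝ × ℝ) ∈ closedOctant := ⟨le_rfl, le_rfl, le_rfl⟩
  have key := taylor h hc h0 hz
  rw [gradA_zero h] at key
  have h1 : valueA p q r A 1 C 0 = 0 := by simp [valueA]
  refine key.trans' ?_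
  rw [h1, covector_apply]
  have := hz.1
  simp
  positivity

lemma rpow_mul_rpow_le {p : ℝ} (hp : 1 < p) {x y s : ℝ} (hx : 0 < x) (hy : 0 < y) :
    x * y ^ (s - s / p) ≤ 1 / p * x ^ p + (1 - 1 / p) * y ^ s := by
  have hp0 : 0 < p := by linarith
  have h1 : 1 / p ≤ 1 := (div_le_one hp0).2 hp.le
  have key := Real.geom_mean_le_arith_mean2_weighted (w₁ := 1 / p) (w₂ := 1 - 1 / p)
    (one_div_pos.2 hp0).le (by linarith) (Real.rpow_nonneg hx.le p) (Real.rpow_nonneg hy.le s)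
    (by ring)
  rw [← Real.rpow_mul hx.le, ← Real.rpow_mul hy.le, mul_one_div_cancel hp0.ne',
    Real.rpow_one] at key
  convert key using 3
  ring

/-- In the second to fourth regions Young's inequality bounds the mixed monomials, and the multiples
of u^p/(p − 1) it produces are exactly those subtracted in the coefficient of u^p. In the last two
regions the monomials containing v² are at most w^r. -/
lemma valueA_le_openOctant {p q r A C : ℝ} (h : Exponents p q r) (hc : Coefficients p q r A C)
    {z : ℝ × ℝ × ℝ} (hz : z ∈ openOctant) :
    valueA p q r A 1 C z ≤ A * z.1 ^ p + 8 * C * z.2.1 ^ q + 8 * C * z.2.2 ^ r := by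
  obtain ⟨u, v, w⟩ := z
  have hz' := hz
  obtain ⟨hu, hv, hw⟩ := hz'
  simp only at hu hv hw
  obtain ⟨aQ, aD, bP, bD, cP, cQ, cD, haQ, haD, hbP, hbD, hcP, hcQ, hcD, e1, e2, e3, e4, e5, e6,
    e7, e8, e9, i1, i2, i3, i4, i5, i6⟩ := monomial_relations h hu hv hw
  obtain ⟨i, hi⟩ := exists_ordering (u ^ p) (v ^ q) (w ^ r)
  have y1 := rpow_mul_rpow_le h.one_lt_p hu hv (s := q)
  have y2 := rpow_mul_rpow_le h.one_lt_p hu hw (s := r)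
  have ha := Real.rpow_pos_of_pos hu p
  have hb := Real.rpow_pos_of_pos hv q
  have hcc := Real.rpow_pos_of_pos hw r
  have hp := h.p_pos
  have hp1 : 0 < p - 1 := by linarith [h.one_lt_p]
  have hq := h.q_pos
  have hr := h.r_pos
  have hrq := h.r_lt_q
  have hq2 : 0 < q - 2 := by linarith [h.two_lt_q]
  have hC := hc.lower_bound h
  have hC1 : 1 ≤ C := by nlinarith
  have hCq : q / 2 ≤ C := by nlinarith
  have hCp := hc.pos h
  have young : ∀ {m a b : ℝ}, m ≤ 1 / p * a + (1 - 1 / p) * b →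
      p / (p - 1) * m ≤ a / (p - 1) + b := fun {m a b} hm => by
    have := mul_le_mul_of_nonneg_left hm (div_pos hp hp1).le
    refine this.trans_eq ?_
    field_simp
  have y1' := young y1
  have y2' := young y2
  have y2C := mul_le_mul_of_nonneg_left y2' hCp.le
  -- The coefficients with denominator q − 2 are thus parts of a convex combination, so their sum
  -- stays bounded even when q is close to 2.
  have hconv : q / (p * (q - 2)) + (q - r) / (r * (q - 2)) = 1 := by
    have := h.mul_denom
    field_simp
    linear_combination -this
  have hk1 : 0 ≤ q / (p * (q - 2)) := by positivity
  have hk2 : 0 ≤ (q - r) / (r * (q - 2)) :=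
    div_nonneg (by linarith) (by positivity)
  have hqr2 : 0 ≤ (q - r) / (2 * r) := div_nonneg (by linarith) (by linarith)
  have hbC := mul_le_mul_of_nonneg_right hC1 hb.le
  have hcC := mul_le_mul_of_nonneg_right hC1 hcc.le
  have hcq := mul_le_mul_of_nonneg_right hCq hcc.le
  have hbC' := mul_pos hCp hb
  have hcC' := mul_pos hCp hcc
  have tail : ∀ {m : ℝ}, m ≤ w ^ r →
      1 * q * (q - r) / (2 * r * (q - 2)) * m + (2 * C * r - 1 * (q - r)) / (2 * r) * w ^ r
      ≤ q / 2 * ((q - r) / (r * (q - 2)) * w ^ r) + C * w ^ r := by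
    intro m hm
    have h1 : 1 * q * (q - r) / (2 * r * (q - 2)) = q / 2 * ((q - r) / (r * (q - 2))) := by
      field_simp
    have h2 : (2 * C * r - 1 * (q - r)) / (2 * r) = C - (q - r) / (2 * r) := by field_simp
    have h3 : q / 2 * ((q - r) / (r * (q - 2))) * m ≤
        q / 2 * ((q - r) / (r * (q - 2))) * w ^ r := by gcongr
    have h4 := mul_nonneg hqr2 hcc.le
    rw [h1, h2]
    linarith
  rw [← eval_terms_of_mem_openOctant h A 1 C i hz hi]
  fin_cases i <;> obtain ⟨h1, h2⟩ := hi <;>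
    simp only [terms, Terms.eval, Terms.weighted_cons, Terms.weighted_nil, Real.rpow_zero,
      Real.rpow_one, Real.rpow_two]
  · linarith
  · have e : (A * (p - 1) - C) / (p - 1) * u ^ p + C * p / (p - 1) * (u * w ^ (r - r / p))
        = A * u ^ p + C * (p / (p - 1) * (u * w ^ (r - r / p))) - C * (u ^ p / (p - 1)) := by
      field_simp; ring
    linarith
  · have e : (A * (p - 1) - (1 + C)) / (p - 1) * u ^ p
        + 1 * p / (p - 1) * (u * v ^ (q - q / p)) + C * p / (p - 1) * (u * w ^ (r - r / p))
        = A * u ^ p + p / (p - 1) * (u * v ^ (q - q / p))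
          + C * (p / (p - 1) * (u * w ^ (r - r / p)))
          - (u ^ p / (p - 1)) - C * (u ^ p / (p - 1)) := by
      field_simp; ring
    linarith
  · have hm : u * v ^ 2 * w ^ (1 - r / q) ≤ u * w ^ (r - r / p) := by
      obtain ⟨-, k1, -⟩ := i5 h1
      rw [e7, e6, mul_assoc]
      gcongr
    have hm' := mul_le_mul_of_nonneg_left hm (half_pos hq).le
    -- The coefficient q/2 splits into a part handled by Young's inequality and a part cancelled by
    -- the negative term in the coefficient of u w^(r − r/p).
    have hk : q / 2 = p / (p - 1) + p * (q - r) / (2 * r * (p - 1)) := by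
      have := h.mul_denom
      field_simp
      linear_combination this
    have e : (A * (p - 1) - (1 + C)) / (p - 1) * u ^ p
        + (2 * C * p * r - 1 * p * (q - r)) / (2 * r * (p - 1)) * (u * w ^ (r - r / p))
        = A * u ^ p + C * (p / (p - 1) * (u * w ^ (r - r / p)))
          - p * (q - r) / (2 * r * (p - 1)) * (u * w ^ (r - r / p))
          - (u ^ p / (p - 1)) - C * (u ^ p / (p - 1)) := by
      field_simp; ring
    rw [hk] at hm'
    have e' : 1 * q / 2 * (u * v ^ 2 * w ^ (1 - r / q)) =
      (p / (p - 1) + p * (q - r) / (2 * r * (p - 1))) * (u * v ^ 2 * w ^ (1 - r / q)) := by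
      rw [← hk]; ring
    linarith
  · obtain ⟨-, k1, k2⟩ := i2 h1
    obtain ⟨-, k6, -⟩ := i5 (h1.trans h2)
    have hm2 : u ^ (p - 2 * p / q) * v ^ 2 ≤ w ^ r := by
      refine le_trans ?_ h2
      rw [e8, e1]
      calc u * aD * v ^ 2 = u * v ^ 2 * aD := by ring
        _ ≤ u * aQ ^ 2 * aD := by gcongr
    have hm3 : v ^ 2 * w ^ (r - 2 * r / q) ≤ w ^ r := by
      rw [e9, e3]
      calc v ^ 2 * (cP * cD) = cP * v ^ 2 * cD := by ring
        _ ≤ cP * cQ ^ 2 * cD := by gcongr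
    have e : (2 * A * r * (p - 1) - 1 * (q + r)) / (2 * r * (p - 1)) * u ^ p
        = A * u ^ p - (q + r) / (2 * r * (p - 1)) * u ^ p := by
      field_simp
    have e' : 1 * q ^ 2 / (2 * p * (q - 2)) = q / 2 * (q / (p * (q - 2))) := by
      field_simp
    have e'' : 0 ≤ (q + r) / (2 * r * (p - 1)) * u ^ p := by positivity
    have hm2' : q / 2 * (q / (p * (q - 2))) * (u ^ (p - 2 * p / q) * v ^ 2)
      ≤ q / 2 * (q / (p * (q - 2))) * w ^ r := by gcongr
    have e3' : q / 2 * (q / (p * (q - 2))) * w ^ r + q / 2 * ((q - r) / (r * (q - 2)) * w ^ r)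
        = q / 2 * w ^ r := by linear_combination (q / 2 * w ^ r) * hconv
    rw [e']
    linarith [tail hm3]
  · obtain ⟨-, k6, -⟩ := i5 h2
    have hm3 : v ^ 2 * w ^ (r - 2 * r / q) ≤ w ^ r := by
      rw [e9, e3]
      calc v ^ 2 * (cP * cD) = cP * v ^ 2 * cD := by ring
        _ ≤ cP * cQ ^ 2 * cD := by gcongr
    have t1 : q / (p * (q - 2)) * v ^ q ≤ 1 * v ^ q := by gcongr; linarith
    have t2 : q / 2 * ((q - r) / (r * (q - 2)) * w ^ r) ≤ q / 2 * (1 * w ^ r) := by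
      gcongr; linarith
    have t3 := tail hm3
    simp only [one_mul, mul_one, add_zero] at t1 t2 t3 hbC hcC ⊢
    generalize q / (p * (q - 2)) * v ^ q = k₁ at *
    generalize q / 2 * ((q - r) / (r * (q - 2)) * w ^ r) = k₂ at *
    linarith only [t1, t2, t3, hbC, hbC', hcq, hcC']

lemma valueA_le {p q r A C : ℝ} (h : Exponents p q r) (hc : Coefficients p q r A C)
    {z : ℝ × ℝ × ℝ} (hz : z ∈ closedOctant) :
    valueA p q r A 1 C z ≤ A * z.1 ^ p + 8 * C * z.2.1 ^ q + 8 * C * z.2.2 ^ r := by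
  have t1 := tendsto_add_smul_one_openOctant hz
  have hcont : Continuous fun z : ℝ × ℝ × ℝ =>
      A * z.1 ^ p + 8 * C * z.2.1 ^ q + 8 * C * z.2.2 ^ r := by
    have h1 := h.p_pos.le
    have h2 := h.q_pos.le
    have h3 := h.r_pos.le
    fun_prop (disch := (intro _; right; assumption))
  refine le_of_tendsto_of_tendsto
    (((continuousOn_valueA h A 1 C z hz).mono openOctant_subset).tendsto.comp t1)
    ((hcont.tendsto z).comp (tendsto_add_smul_one z)) ?_
  filter_upwards [self_mem_nhdsWithin] with ε hε
  exact valueA_le_openOctant h hc (add_smul_one_mem_openOctant hz hε)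

/-- Ap = 8Cq · p/(p − 1) ≥ 8Cq, and C ≥ 1 and q > r make this exceed q and Cr as well. -/
lemma bellmanConst_eq {p q r A C : ℝ} (h : Exponents p q r) (hc : Coefficients p q r A C) :
    bellmanConst p q r A 1 C = A * p ∧ 8 * C ≤ A * p / q ∧ 8 * C ≤ A * p / r := by
  have hp := h.p_pos
  have hp1 : 0 < p - 1 := by linarith [h.one_lt_p]
  have hq := h.q_pos
  have hr := h.r_pos
  have hrq := h.r_lt_q
  have hq2 := h.two_lt_q
  have hC := hc.lower_bound h
  have hCp := hc.pos h
  have h1 : 8 * C * q ≤ A * p := by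
    have : A * p = 8 * C * q * (p / (p - 1)) := by rw [hc.eqA]; ring
    rw [this]
    refine le_mul_of_one_le_right (by positivity) ?_
    rw [le_div_iff₀ hp1]
    linarith
  have h2 : C * r ≤ C * q := by gcongr
  have h3 : 0 ≤ C * q := by positivity
  have h4 : 1 * q ≤ C * q := by gcongr; nlinarith
  refine ⟨?_, ?_, ?_⟩
  · rw [bellmanConst, max_eq_left]
    exact max_le (by linarith) (by linarith)
  · rw [le_div_iff₀ hq]; linarith
  · rw [le_div_iff₀ hr]; linarith

lemma rangeBound {p q r A C : ℝ} (h : Exponents p q r) (hc : Coefficients p q r A C) :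
    RangeBound p q r A 1 C := by
  rintro ⟨⟨u, v, w⟩, ⟨U, V, W⟩⟩ ⟨hz, -, hU, hV, hW⟩
  simp only at hz hU hV hW
  obtain ⟨k1, k2, k3⟩ := bellmanConst_eq h hc
  have hp := h.p_pos
  have hCp := hc.pos h
  have hAp : 0 ≤ A := by
    have hp1 : 0 < p - 1 := by linarith [h.one_lt_p]
    have hq := h.q_pos
    rw [hc.eqA]; positivity
  simp only [funB, funA_eq_valueA h A 1 C hz, k1]
  have h1 := valueA_le h hc hz
  have h2 := valueA_nonneg h hc hz
  simp only at h1
  have e : A * p * (1 / p * U + 1 / q * V + 1 / r * W)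
      = A * U + A * p / q * V + A * p / r * W := by
    field_simp
  refine ⟨?_, by linarith⟩
  rw [e]
  have k2' : 0 ≤ A * p / q := k2.trans' (by positivity)
  have k3' : 0 ≤ A * p / r := k3.trans' (by positivity)
  have t1 := mul_le_mul_of_nonneg_left hU hAp
  have t2 : 8 * C * v ^ q ≤ A * p / q * V := by
    have := Real.rpow_nonneg hz.2.1 q
    gcongr
  have t3 : 8 * C * w ^ r ≤ A * p / r * W := by
    have := Real.rpow_nonneg hz.2.2 r
    gcongr
  linarith

/-! ### The midpoint and tangent plane inequalities -/

/-- `taylor` is applied from the midpoint to both endpoints. The linear terms cancel on averaging,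
|vᵢ − v| = |v₁ − v₂|/2 (likewise for w), and the weights 2u/3 + uᵢ/3 average to exactly u. -/
lemma mainInequality {p q r A C : ℝ} (h : Exponents p q r) (hc : Coefficients p q r A C) :
    MainInequality p q r A 1 C := by
  rintro x hx x₁ hx₁ x₂ hx₂ rfl
  have t1 := taylor h hc hx.1 hx₁.1
  have t2 := taylor h hc hx.1 hx₂.1
  simp only [funB, funA_eq_valueA h A 1 C hx.1, funA_eq_valueA h A 1 C hx₁.1,
    funA_eq_valueA h A 1 C hx₂.1]
  obtain ⟨⟨u₁, v₁, w₁⟩, ⟨U₁, V₁, W₁⟩⟩ := x₁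
  obtain ⟨⟨u₂, v₂, w₂⟩, ⟨U₂, V₂, W₂⟩⟩ := x₂
  simp only [Prod.smul_mk, Prod.mk_add_mk, smul_eq_mul, covector_apply, Prod.mk_sub_mk]
    at t1 t2 ⊢
  have d : ∀ s t : ℝ, |s - (1 / 2 * s + 1 / 2 * t)| = |s - t| / 2 ∧
      |t - (1 / 2 * s + 1 / 2 * t)| = |s - t| / 2 := fun s t => by
    constructor
    · rw [show s - (1 / 2 * s + 1 / 2 * t) = (s - t) / 2 by ring, abs_div, abs_two]
    · rw [show t - (1 / 2 * s + 1 / 2 * t) = (t - s) / 2 by ring, abs_div, abs_two, abs_sub_comm]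
  rw [(d v₁ v₂).1, (d w₁ w₂).1] at t1
  rw [(d v₁ v₂).2, (d w₁ w₂).2] at t2
  linarith

/-- The weight in `taylor` is 2u/3 + u₁/3, and the nonnegative u₁/3 is dropped. -/
lemma tangentInequality {p q r A C : ℝ} (h : Exponents p q r) (hc : Coefficients p q r A C) :
    TangentInequality p q r A 1 C := by
  rintro x hx x₁ hx₁
  have t := taylor h hc hx.1 hx₁.1
  simp only [funB, diffB, funA_eq_valueA h A 1 C hx.1, funA_eq_valueA h A 1 C hx₁.1,
    diffA_eq h A 1 C hx.1, Prod.fst_sub, Prod.snd_sub]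
  have hu : 0 ≤ x₁.1.1 := hx₁.1.1
  have : 0 ≤ |x₁.1.2.1 - x.1.2.1| * |x₁.1.2.2 - x.1.2.2| * (x₁.1.1 / 3) := by positivity
  linarith

end Bellman

end

theorem theorem1 (p q r : ℝ) (hp : 1 < p) (hq : 1 < q) (hr : 1 < r) (hqr : r < q)
    (hsum : 1 / p + 1 / q + 1 / r = 1) :
    (∃ A B C : ℝ, Bellman.Admissible p q r A B C) ∧
    Bellman.Admissible p q r
      (88 * q ^ 4 * r / ((p - 1) * (r - 1) * (q - r)))
      1
      (11 * q ^ 3 * r / ((r - 1) * (q - r))) ∧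
    Bellman.bellmanConst p q r
      (88 * q ^ 4 * r / ((p - 1) * (r - 1) * (q - r)))
      1
      (11 * q ^ 3 * r / ((r - 1) * (q - r)))
      = 88 * p * q ^ 4 * r / ((p - 1) * (r - 1) * (q - r)) := by
  have h : Bellman.Exponents p q r := ⟨hp, hq, hr, hqr, hsum⟩
  have hp1 : 0 < p - 1 := by linarith
  have hr1 : 0 < r - 1 := by linarith
  have hqr' : 0 < q - r := by linarith
  have hq0 := h.q_pos
  have hr0 := h.r_pos
  have hc : Bellman.Coefficients p q r (88 * q ^ 4 * r / ((p - 1) * (r - 1) * (q - r)))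
      (11 * q ^ 3 * r / ((r - 1) * (q - r))) :=
    ⟨by field_simp; norm_num, rfl⟩
  have hadm : Bellman.Admissible p q r (88 * q ^ 4 * r / ((p - 1) * (r - 1) * (q - r))) 1
      (11 * q ^ 3 * r / ((r - 1) * (q - r))) :=
    ⟨⟨by positivity, one_pos, by positivity⟩, Bellman.agreesWithFormulas h _ _ _,
      Bellman.isC1 h _ _ _, Bellman.rangeBound h hc, Bellman.mainInequality h hc,
      Bellman.tangentInequality h hc⟩
  refine ⟨⟨_, _, _, hadm⟩, hadm, ?_⟩
  rw [(Bellman.bellmanConst_eq h hc).1]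
  ring
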